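/- Let $\mathbb{H}$ be the upper half-plane, $n(2)=3$, $n(3)=4$, $n(4)=6$, $n(5)=12$, and let $\Gamma(N)\subset \mathrm{SL}_2(\mathbb{Z})$ be the principal congruence subgroup of level $N$. For $N\in\{2,3,4,5\}$ there are polynomials $C_m\in\mathbb{C}[X]$ ($m\ge 3$), depending only on $N$, such that the following hold. Let $S\subset\mathbb{CP}^1=\mathbb{C}\cup\{\infty\}$ be any set of $n(N)$ points with $0\in S$, and let $f:\mathbb{H}\to\mathbb{CP}^1\setminus S$ be any (holomorphic) universal covering whose group of deck transformations is $\Gamma(N)$, acting by Möbius transformations, and which vanishes at infinity: $f(\tau)\to 0$ as $\operatorname{Im}\tau\to\infty$. 1. There are constants $A,B\in\mathbb{C}$, $A\ne 0$, such that, with $q_N=e^{2\pi i\tau/N}$, $$f(\tau)=A\Big(q_N+\tfrac{B}{A}\,q_N^2+\sum_{m=3}^{\infty}C_m\big(\tfrac{B}{A}\big)\,q_N^m\Big).$$ The series converges to $f$ on every half-plane $\{\operatorname{Im}\tau>Y\}$, $Y \in \mathbb{R}$, on which $f$ has no pole, and there is such a half-plane; if $f$ has no pole (that is, if $\infty\in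 S$), this holds on all of $\mathbb{H}$. 2. $A$ and $B$ are uniquely determined by the punctures, each labelled by the cusps where $f$ takes it as a value: if $f$ and $g$ are two such coverings (for the same $N$) and $\lim_{\operatorname{Im}\tau\to\infty}f(\gamma\tau)=\lim_{\operatorname{Im}\tau\to\infty}g(\gamma\tau)$ in $\mathbb{CP}^1$ for all $\gamma\in\mathrm{SL}_2(\mathbb{Z})$, then $f$ and $g$ have the same constants $A,B$. 3. The unlabelled set $S$ determines $(A,B)$ up to the Möbius symmetries of $S$ that fix $0$: if $f$ and $g$ are two such coverings with the same $S$ and with constants $(A,B)$ and $(A',B')$, then there is a Möbius transformation $z\mapsto \frac{uz}{1+vz}$ ($u,v\in\mathbb{C}$, $u\ne0$) that maps $S$ onto itself, with $A'=uA$ and $B'=u(B-vA^2)$. -/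

import Mathlib

open UpperHalfPlane Filter Topology OnePoint
open scoped Manifold MatrixGroups

noncomputable section

/-- The numbers `n(2) = 3`, `n(3) = 4`, `n(4) = 6`, `n(5) = 12` of omitted points
(only `N = 2, 3, 4, 5` are used). -/
def numPunctures : ℕ → ℕ
  | 2 => 3
  | 3 => 4
  | 4 => 6
  | 5 => 12
  | _ => 0

/-- The standard coordinate of the Riemann sphere `OnePoint ℂ`, a chart on the complement of `∞`
(the value at `∞` is irrelevant). -/
def affineCoord : OnePoint ℂ → ℂ
  | ∞ => 0
  | (z : ℂ) => z

/-- The coordinate `1 / z` of the Riemann sphere `OnePoint ℂ`, a chart on the complement of `0`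
with `∞ ↦ 0` (the value at `0` is irrelevant). -/
def coordAtInfty : OnePoint ℂ → ℂ
  | ∞ => 0
  | (z : ℂ) => z⁻¹

/-- Holomorphic maps from the upper half-plane to the Riemann sphere: continuous maps that are
complex differentiable in the two standard charts of the sphere. -/
def IsHolomorphicToSphere (F : ℍ → OnePoint ℂ) : Prop :=
  Continuous F ∧ ∀ τ : ℍ,
    (F τ ≠ ∞ → MDifferentiableAt 𝓘(ℂ) 𝓘(ℂ) (fun σ => affineCoord (F σ)) τ) ∧
    (F τ ≠ ((0 : ℂ) : OnePoint ℂ) →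
      MDifferentiableAt 𝓘(ℂ) 𝓘(ℂ) (fun σ => coordAtInfty (F σ)) τ)

/-- `f : ℍ → ℂℙ¹ ∖ S` is a universal covering of Riemann surfaces: a holomorphic covering map
(its source `ℍ` is simply connected). -/
def IsUniversalCovering {S : Finset (OnePoint ℂ)} (f : ℍ → ↥((S : Set (OnePoint ℂ))ᶜ)) : Prop :=
  IsHolomorphicToSphere (fun τ => (f τ : OnePoint ℂ)) ∧ IsCoveringMap f

/-- The deck transformation group of `f` is `Γ(N)`: the self-homeomorphisms `h` of `ℍ` with
`f ∘ h = f` are exactly the Möbius transformations given by the matrices of `Γ(N)`. -/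
def HasDeckGroupGamma {X : Type*} (N : ℕ) (f : ℍ → X) : Prop :=
  ∀ h : ℍ ≃ₜ ℍ, (∀ τ, f (h τ) = f τ) ↔ ∃ γ ∈ CongruenceSubgroup.Gamma N, ∀ τ, h τ = γ • τ

/-- The value of `F` at the cusp `γ(∞)` is `p`: `F (γ τ) → p` as `Im τ → ∞`. -/
def HasValueAtCusp (F : ℍ → OnePoint ℂ) (γ : SL(2, ℤ)) (p : OnePoint ℂ) : Prop :=
  Tendsto (fun τ : ℍ => F (γ • τ)) atImInfty (𝓝 p)

/-- `f : ℍ → ℂℙ¹ ∖ S` is a universal covering of the complement of a set `S` of `n(N)` points, one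
of which is `0`, with deck transformation group `Γ(N)` and `f(∞) = 0`. -/
structure IsPuncturedSphereCovering (N : ℕ) (S : Finset (OnePoint ℂ))
    (f : ℍ → ↥((S : Set (OnePoint ℂ))ᶜ)) : Prop where
  card_eq : S.card = numPunctures N
  zero_mem : ((0 : ℂ) : OnePoint ℂ) ∈ S
  isUniversalCovering : IsUniversalCovering f
  deckGroup : HasDeckGroupGamma N f
  vanishes : HasValueAtCusp (fun τ => (f τ : OnePoint ℂ)) 1 ((0 : ℂ) : OnePoint ℂ)

/-- The expansion `F = A (q + (B/A) q² + ∑_{m ≥ 3} C_m(B/A) q^m)` in `q = exp (2πiτ/N)`, with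
`A ≠ 0`. It is an expansion at the cusp `∞`: it converges to `F` on every half-plane `Im τ > Y`
on which `F` has no pole, and there is such a half-plane. If `F` has no pole at all, it converges
to `F` on all of `ℍ`. -/
def HasExpansion (N : ℕ) (C : ℕ → Polynomial ℂ) (F : ℍ → OnePoint ℂ) (A B : ℂ) : Prop :=
  A ≠ 0 ∧ (∃ Y : ℝ, ∀ τ : ℍ, Y < τ.im → F τ ≠ ∞) ∧
  ∀ Y : ℝ, (∀ τ : ℍ, Y < τ.im → F τ ≠ ∞) → ∀ τ : ℍ, Y < τ.im →
    ∃ s : ℂ,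
      HasSum (fun m : ℕ =>
        (C (m + 3)).eval (B / A) * Function.Periodic.qParam (N : ℝ) (τ : ℂ) ^ (m + 3)) s ∧
      F τ = ((A * (Function.Periodic.qParam (N : ℝ) (τ : ℂ) +
        B / A * Function.Periodic.qParam (N : ℝ) (τ : ℂ) ^ 2 + s) : ℂ) : OnePoint ℂ)

end

/-! The deck group of a simply connected covering is transitive on fibres
(`IsCoveringMap.exists_homeomorph_of_eq`), so any two of the coverings `f`, `g` have the same
fibres, the orbits of `Γ(N)`. Hence `g ∘ f⁻¹` is a well-defined injective holomorphic map between
punctured spheres, and such a map is Möbius (`exists_gl_smul_eq`): if `c` is a value of `g` and `w₀`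
the corresponding value of `f`, then `1 / (g - c)`, as a function of `w = f`, is bounded away from
`w₀` and has a simple pole there, so removable singularities and Liouville's theorem determine it.
Both maps vanish at the cusp, which leaves `g = u f / (1 + v f)`.

In the variable `q`, `f` is holomorphic at `0` and injective nearby, so `A ≠ 0`
(`deriv_cuspExpansion_ne_zero`). The coefficients of `u f₀ / (1 + v f₀)`, with `f₀` one fixed
covering, are `u` times polynomials in `v` (`exists_polynomial_coeff`), and `v` is an affine
function of `B / A`; this produces the `C m` without any explicit modular function.

Every puncture is a value at some cusp (`exists_valueAtCusp_eq`), so equal labels make the Möbius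
map fix all punctures; as there are at least three, it is the identity. If only `S` is shared, the
map still preserves `S` (`smul_mem_iff`), and its effect on `A`, `B` is `coeff_one_two`. -/

noncomputable section

/-! ### Local complex analysis: injectivity, removable singularities, simple poles. -/

/-- An analytic function that is nonzero at a point has an analytic `n`-th root there. -/
lemma AnalyticAt.exists_analyticAt_pow_eq {h : ℂ → ℂ} {z₀ : ℂ} (hh : AnalyticAt ℂ h z₀)
    (h0 : h z₀ ≠ 0) {n : ℕ} (hn : n ≠ 0) :
    ∃ k : ℂ → ℂ, AnalyticAt ℂ k z₀ ∧ k z₀ ≠ 0 ∧ ∀ᶠ z in 𝓝 z₀, k z ^ n = h z := by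
  obtain ⟨r, hr⟩ := IsAlgClosed.exists_pow_nat_eq (h z₀) (Nat.pos_of_ne_zero hn)
  have hr0 : r ≠ 0 := by rintro rfl; exact h0 (by rw [← hr, zero_pow hn])
  have hd : AnalyticAt ℂ (fun z => h z / h z₀) z₀ := hh.div analyticAt_const h0
  refine ⟨fun z => r * Complex.exp (Complex.log (h z / h z₀) / n), ?_, ?_, ?_⟩
  · refine analyticAt_const.mul (AnalyticAt.cexp ?_)
    refine (hd.clog ?_).div analyticAt_const (by exact_mod_cast hn)
    simp [h0]
  · simp [hr0]
  · filter_upwards [hh.continuousAt.eventually_ne h0] with z hz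
    rw [mul_pow, ← Complex.exp_nat_mul, mul_div_cancel₀ _ (by exact_mod_cast hn),
      Complex.exp_log (div_ne_zero hz h0), hr, mul_div_cancel₀ _ h0]

/-- The derivative of an injective holomorphic function does not vanish. -/
theorem AnalyticAt.deriv_ne_zero_of_injOn {f : ℂ → ℂ} {z₀ : ℂ} (hf : AnalyticAt ℂ f z₀)
    {U : Set ℂ} (hU : U ∈ 𝓝 z₀) (hinj : Set.InjOn f U) : deriv f z₀ ≠ 0 := by
  have hg : AnalyticAt ℂ (fun z => f z - f z₀) z₀ := hf.sub analyticAt_const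
  have hne : analyticOrderAt (fun z => f z - f z₀) z₀ ≠ ⊤ := by
    intro htop
    rw [analyticOrderAt_eq_top] at htop
    have hmem : ∀ᶠ z in 𝓝[≠] z₀, f z - f z₀ = 0 ∧ z ∈ U ∧ z ≠ z₀ := by
      filter_upwards [nhdsWithin_le_nhds htop, nhdsWithin_le_nhds hU, self_mem_nhdsWithin]
        with z h1 h2 h3 using ⟨h1, h2, h3⟩
    obtain ⟨z, h1, h2, h3⟩ := hmem.exists
    exact h3 (hinj h2 (mem_of_mem_nhds hU) (sub_eq_zero.mp h1))
  obtain ⟨h, hh, h0, hfac⟩ := (hg.analyticOrderAt_ne_top).mp hne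
  set n := analyticOrderNatAt (fun z => f z - f z₀) z₀ with hn
  have hn0 : n ≠ 0 := by
    intro hz
    have := hfac.self_of_nhds
    rw [hz] at this
    simp only [sub_self, pow_zero, one_smul] at this
    exact h0 this.symm
  by_contra hder
  obtain ⟨k, hk, hk0, hkn⟩ := hh.exists_analyticAt_pow_eq h0 hn0
  -- In the local coordinate `G`, `f - f z₀` is an `n`-th power. For `n ≥ 2` the points with
  -- coordinates `w` and `ζ * w` have the same image, which contradicts injectivity.
  set G : ℂ → ℂ := fun z => (z - z₀) * k z with hG
  have hGd : HasStrictDerivAt G (k z₀) z₀ := by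
    have h1 : HasStrictDerivAt (fun z => z - z₀) 1 z₀ := (hasStrictDerivAt_id z₀).sub_const z₀
    simpa [hG] using! h1.mul hk.hasStrictDerivAt
  have hmap := hGd.map_nhds_eq hk0
  have hG0 : G z₀ = 0 := by simp [hG]
  rw [hG0] at hmap
  have hfG : ∀ᶠ z in 𝓝 z₀, f z - f z₀ = G z ^ n := by
    filter_upwards [hfac, hkn] with z h1 h2
    rw [h1, hG, mul_pow, h2, smul_eq_mul]
  have hn1 : n ≠ 1 := by
    intro h1
    have h2 : HasDerivAt (fun z => f z - f z₀) (k z₀) z₀ :=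
      hGd.hasDerivAt.congr_of_eventuallyEq 
        (hfG.mono fun z hz => by simpa [h1] using hz)
    have h3 := (h2.add_const (f z₀)).deriv
    simp only [sub_add_cancel] at h3
    exact hk0 (h3.symm.trans hder)
  have hV : G '' (U ∩ {z | f z - f z₀ = G z ^ n}) ∈ 𝓝 (0 : ℂ) := by
    rw [← hmap]
    exact image_mem_map (inter_mem hU hfG)
  have hζ := Complex.isPrimitiveRoot_exp n hn0
  set ζ := Complex.exp (2 * Real.pi * Complex.I / n)
  have hV' : ∀ᶠ w in 𝓝 (0 : ℂ), ζ * w ∈ G '' (U ∩ {z | f z - f z₀ = G z ^ n}) := by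
    have : Tendsto (fun w : ℂ => ζ * w) (𝓝 0) (𝓝 0) := by
      simpa using (continuous_const_mul ζ).tendsto 0
    exact this hV
  have hex : ∀ᶠ w in 𝓝[≠] (0 : ℂ), w ∈ G '' (U ∩ {z | f z - f z₀ = G z ^ n}) ∧
      ζ * w ∈ G '' (U ∩ {z | f z - f z₀ = G z ^ n}) ∧ w ≠ 0 := by
    filter_upwards [nhdsWithin_le_nhds hV, nhdsWithin_le_nhds hV', self_mem_nhdsWithin]
      with w a b c using ⟨a, b, c⟩
  obtain ⟨w, ⟨z, ⟨hz, hz'⟩, hzw⟩, ⟨y, ⟨hy, hy'⟩, hyw⟩, hw⟩ := hex.exists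
  have hzy : z = y := by
    apply hinj hz hy
    have : f z - f z₀ = f y - f z₀ := by
      rw [hz', hy', hzw, hyw, mul_pow, hζ.pow_eq_one, one_mul]
    simpa using this
  rw [← hzy, hzw] at hyw
  have : ζ = 1 := by
    have := mul_right_cancel₀ hw (hyw.symm.trans (one_mul w).symm)
    exact this
  exact hζ.ne_one (by omega) this

/-- A bounded holomorphic function on the complement of a finite set is constant. -/
theorem exists_eq_const_of_bounded_compl_finset (s : Finset ℂ) :
    ∀ f : ℂ → ℂ, (∀ z ∉ s, DifferentiableAt ℂ f z) → (∃ K, ∀ z ∉ s, ‖f z‖ ≤ K) →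
      ∃ c, ∀ z ∉ s, f z = c := by
  induction s using Finset.induction_on with
  | empty =>
    intro f hf ⟨K, hK⟩
    refine ⟨f 0, fun z _ => ?_⟩
    refine Differentiable.apply_eq_apply_of_bounded (fun z => hf z (by simp)) ?_ z 0
    rw [isBounded_iff_forall_norm_le]
    exact ⟨K, by rintro _ ⟨z, rfl⟩; exact hK z (by simp)⟩
  | insert a s ha ih =>
    intro f hf ⟨K, hK⟩
    have hnhds : ((s : Set ℂ)ᶜ) ∈ 𝓝 a := s.finite_toSet.isClosed.isOpen_compl.mem_nhds (by simpa)
    have hd : DifferentiableOn ℂ f ((s : Set ℂ)ᶜ \ {a}) := fun z hz =>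
      (hf z (by simpa [not_or] using ⟨hz.2, hz.1⟩)).differentiableWithinAt
    have hb : BddAbove (norm ∘ f '' ((s : Set ℂ)ᶜ \ {a})) := by
      refine ⟨K, ?_⟩
      rintro _ ⟨z, hz, rfl⟩
      exact hK z (by simpa [not_or] using ⟨hz.2, hz.1⟩)
    have hu := Complex.differentiableOn_update_limUnder_of_bddAbove hnhds hd hb
    set g := Function.update f a (limUnder (𝓝[≠] a) f) with hg
    have hgf : ∀ z, z ≠ a → g z = f z := fun z hz => Function.update_of_ne hz _ _
    have hgd : ∀ z ∉ s, DifferentiableAt ℂ g z := fun z hz =>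
      hu.differentiableAt (s.finite_toSet.isClosed.isOpen_compl.mem_nhds (by simpa))
    have hga : ‖g a‖ ≤ K := by
      have ht : Tendsto (fun z => ‖g z‖) (𝓝[≠] a) (𝓝 ‖g a‖) :=
        ((hgd a ha).continuousAt.norm.tendsto).mono_left nhdsWithin_le_nhds
      refine le_of_tendsto ht ?_
      filter_upwards [nhdsWithin_le_nhds hnhds, self_mem_nhdsWithin] with z h1 h2
      rw [hgf z h2]
      exact hK z (by simpa [not_or] using ⟨h2, h1⟩)
    obtain ⟨c, hc⟩ := ih g hgd ⟨K, fun z hz => by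
      by_cases hza : z = a
      · rw [hza]; exact hga
      · rw [hgf z hza]; exact hK z (by simp [hza, hz])⟩
    refine ⟨c, fun z hz => ?_⟩
    simp only [Finset.mem_insert, not_or] at hz
    rw [← hgf z hz.1]
    exact hc z hz.2

/-- If `φ` has a simple zero at `w₀`, then `1 / φ` minus its principal part is bounded. -/
lemma AnalyticAt.exists_norm_inv_sub_le {φ : ℂ → ℂ} {w₀ : ℂ} (hφ : AnalyticAt ℂ φ w₀)
    (h0 : φ w₀ = 0) (h1 : deriv φ w₀ ≠ 0) :
    ∃ K, ∀ᶠ w in 𝓝[≠] w₀, ‖(φ w)⁻¹ - (deriv φ w₀)⁻¹ / (w - w₀)‖ ≤ K := by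
  obtain ⟨s, hs, hsd⟩ := hφ.eventually_analyticAt.exists_mem
  have hφd : DifferentiableOn ℂ φ s := fun z hz => (hsd z hz).differentiableAt.differentiableWithinAt
  have hk := (Complex.differentiableOn_dslope hs).mpr hφd
  set k := dslope φ w₀ with hkdef
  have hk0 : k w₀ = deriv φ w₀ := dslope_same _ _
  have hkd : DifferentiableAt ℂ k w₀ := hk.differentiableAt hs
  have hi : DifferentiableAt ℂ (fun w => (k w)⁻¹) w₀ := hkd.inv (by rwa [hk0])
  have hc : ContinuousAt (dslope (fun w => (k w)⁻¹) w₀) w₀ := continuousAt_dslope_same.mpr hi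
  refine ⟨‖dslope (fun w => (k w)⁻¹) w₀ w₀‖ + 1, ?_⟩
  have hev : ∀ᶠ w in 𝓝 w₀, ‖dslope (fun w => (k w)⁻¹) w₀ w‖ <
      ‖dslope (fun w => (k w)⁻¹) w₀ w₀‖ + 1 :=
    hc.norm.eventually_lt continuousAt_const (by simp)
  filter_upwards [nhdsWithin_le_nhds hev, self_mem_nhdsWithin] with w hw hne
  have hne' : w - w₀ ≠ 0 := sub_ne_zero.mpr hne
  -- Since `φ w = (w - w₀) * k w`, what remains is the difference quotient of `1 / k` at `w₀`, which
  -- has a limit.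
  have heq : (φ w)⁻¹ - (deriv φ w₀)⁻¹ / (w - w₀) = dslope (fun w => (k w)⁻¹) w₀ w := by
    rw [dslope_of_ne _ hne, slope_def_field, hk0, hkdef, dslope_of_ne _ hne, slope_def_field, h0,
      sub_zero, inv_div]
    field_simp
  rw [heq]
  exact hw.le

/-- A function on the complement of finitely many points that is bounded away from `w₀`
and has a simple pole at `w₀` is a Möbius transformation. -/
theorem exists_eq_add_div_of_simple_pole (s : Finset ℂ) (w₀ : ℂ) (ψ φ : ℂ → ℂ)
    (hψ : ∀ w ∉ s, w ≠ w₀ → DifferentiableAt ℂ ψ w)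
    (hb : ∀ U ∈ 𝓝 w₀, ∃ K, ∀ w ∉ U, w ∉ s → ‖ψ w‖ ≤ K)
    (hφ : AnalyticAt ℂ φ w₀) (h0 : φ w₀ = 0) (h1 : deriv φ w₀ ≠ 0)
    (hψφ : ∀ᶠ w in 𝓝[≠] w₀, ψ w = (φ w)⁻¹) :
    ∃ α β : ℂ, β ≠ 0 ∧ ∀ w ∉ s, w ≠ w₀ → ψ w = α + β / (w - w₀) := by
  obtain ⟨K, hK⟩ := hφ.exists_norm_inv_sub_le h0 h1
  set β := (deriv φ w₀)⁻¹ with hβ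
  have hev : ∀ᶠ w in 𝓝 w₀, w ≠ w₀ → ‖ψ w - β / (w - w₀)‖ ≤ K := by
    refine eventually_nhdsWithin_iff.mp ?_
    filter_upwards [hK, hψφ] with w h2 h3
    rwa [h3]
  obtain ⟨r, hr, hball⟩ := Metric.eventually_nhds_iff_ball.mp hev
  obtain ⟨L, hL⟩ := hb _ (Metric.ball_mem_nhds w₀ hr)
  obtain ⟨c, hc⟩ := exists_eq_const_of_bounded_compl_finset (insert w₀ s)
    (fun w => ψ w - β / (w - w₀)) (by
      intro z hz
      simp only [Finset.mem_insert, not_or] at hz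
      refine (hψ z hz.2 hz.1).sub ?_
      exact (differentiableAt_const _).div (by fun_prop) (sub_ne_zero.mpr hz.1))
    ⟨max K (L + ‖β‖ / r), by
      intro z hz
      simp only [Finset.mem_insert, not_or] at hz
      by_cases hzb : z ∈ Metric.ball w₀ r
      · exact (hball z hzb hz.1).trans (le_max_left _ _)
      · refine (norm_sub_le _ _).trans (le_trans ?_ (le_max_right _ _))
        refine add_le_add (hL z hzb hz.2) ?_
        rw [norm_div]
        have : r ≤ ‖z - w₀‖ := by simpa [dist_eq_norm] using hzb
        gcongr⟩
  refine ⟨c, β, inv_ne_zero h1, fun w hw hne => ?_⟩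
  rw [← hc w (by simp [hw, hne])]
  ring

/-! ### The Riemann sphere and its Möbius transformations. -/

@[simp] lemma affineCoord_coe (z : ℂ) : affineCoord (z : OnePoint ℂ) = z := rfl

@[simp] lemma coordAtInfty_coe (z : ℂ) : coordAtInfty (z : OnePoint ℂ) = z⁻¹ := rfl

@[simp] lemma coordAtInfty_infty : coordAtInfty ∞ = 0 := rfl

lemma coe_affineCoord {p : OnePoint ℂ} (hp : p ≠ ∞) : (affineCoord p : OnePoint ℂ) = p := by
  induction p using OnePoint.rec with
  | infty => exact absurd rfl hp
  | coe z => rfl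

lemma affineCoord_eq_iff {p : OnePoint ℂ} (hp : p ≠ ∞) {z : ℂ} :
    affineCoord p = z ↔ p = (z : OnePoint ℂ) := by
  rw [← OnePoint.coe_eq_coe, coe_affineCoord hp]

namespace OnePoint

lemma tendsto_coe_infty_of_cobounded {α : Type*} {l : Filter α} {F : α → ℂ}
    (h : Tendsto F l (Bornology.cobounded ℂ)) :
    Tendsto (fun x => (F x : OnePoint ℂ)) l (𝓝 ∞) := by
  have h1 : Tendsto ((↑) : ℂ → OnePoint ℂ) (Bornology.cobounded ℂ) (𝓝 ∞) := by
    rw [nhds_infty_eq, Metric.cobounded_eq_cocompact, coclosedCompact_eq_cocompact]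
    exact le_sup_left
  exact h1.comp h

lemma tendsto_infty_cobounded {α : Type*} {l : Filter α} {F : OnePoint ℂ → α} :
    Tendsto F (𝓝 ∞) l ↔
      Tendsto F (pure ∞) l ∧ Tendsto (fun z : ℂ => F z) (Bornology.cobounded ℂ) l := by
  rw [tendsto_nhds_infty', Metric.cobounded_eq_cocompact, coclosedCompact_eq_cocompact]
  rfl

/-- The quotient of two convergent functions whose limits do not both vanish converges
in the Riemann sphere. -/
lemma tendsto_ite_div {α : Type*} {l : Filter α} {X Y : α → ℂ} {x y : ℂ}
    (hX : Tendsto X l (𝓝 x)) (hY : Tendsto Y l (𝓝 y)) (hxy : y = 0 → x ≠ 0) :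
    Tendsto (fun t => if Y t = 0 then ∞ else ((X t / Y t : ℂ) : OnePoint ℂ)) l
      (𝓝 (if y = 0 then ∞ else ((x / y : ℂ) : OnePoint ℂ))) := by
  by_cases hy : y = 0
  · rw [if_pos hy]
    refine Tendsto.if tendsto_const_nhds (tendsto_coe_infty_of_cobounded ?_)
    rw [← tendsto_norm_atTop_iff_cobounded]
    have h1 : Tendsto Y (l ⊓ 𝓟 {t | ¬Y t = 0}) (𝓝[≠] 0) :=
      tendsto_inf.mpr ⟨(hy ▸ hY).mono_left inf_le_left, tendsto_principal.mpr
        (Filter.Eventually.filter_mono inf_le_right (mem_principal_self _))⟩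
    have h2 := tendsto_norm_atTop_iff_cobounded.mpr (tendsto_inv₀_nhdsNE_zero.comp h1)
    have h3 := (hX.norm.mono_left (inf_le_left (b := 𝓟 {t | ¬Y t = 0}))).pos_mul_atTop
      (norm_pos_iff.mpr (hxy hy)) h2
    simpa [div_eq_mul_inv] using h3
  · rw [if_neg hy]
    have h1 := (continuous_coe.tendsto (x / y)).comp (hX.div hY hy)
    refine h1.congr' ?_
    filter_upwards [hY.eventually_ne hy] with t ht
    simp [ht]

/-- Möbius transformations are continuous on the Riemann sphere. -/
theorem continuous_gl_smul (M : GL (Fin 2) ℂ) : Continuous fun p : OnePoint ℂ => M • p := by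
  have hdet : M 0 0 * M 1 1 - M 0 1 * M 1 0 ≠ 0 := by
    have := M.det_ne_zero
    rwa [Matrix.det_fin_two] at this
  rw [continuous_iff_continuousAt]
  intro p
  induction p using OnePoint.rec with
  | infty =>
    rw [ContinuousAt, tendsto_infty_cobounded]
    refine ⟨tendsto_pure_nhds _ _, ?_⟩
    have hinv : Tendsto (fun z : ℂ => z⁻¹) (Bornology.cobounded ℂ) (𝓝 0) := tendsto_inv₀_cobounded
    -- At `∞`, numerator and denominator are divided by `z`; their limits `M 0 0` and `M 1 0` do not
    -- both vanish.
    have hX : Tendsto (fun z : ℂ => M 0 0 + M 0 1 * z⁻¹) (Bornology.cobounded ℂ) (𝓝 (M 0 0)) := by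
      simpa using (hinv.const_mul (M 0 1)).const_add (M 0 0)
    have hY : Tendsto (fun z : ℂ => M 1 0 + M 1 1 * z⁻¹) (Bornology.cobounded ℂ) (𝓝 (M 1 0)) := by
      simpa using (hinv.const_mul (M 1 1)).const_add (M 1 0)
    have h := tendsto_ite_div hX hY (fun h h' => hdet (by rw [h, h']; ring))
    rw [smul_infty_eq_ite]
    refine h.congr' ?_
    filter_upwards [Bornology.eventually_ne_cobounded (0 : ℂ)] with z hz
    have e1 : M 1 0 + M 1 1 * z⁻¹ = (M 1 0 * z + M 1 1) / z := by field_simp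
    have e0 : M 0 0 + M 0 1 * z⁻¹ = (M 0 0 * z + M 0 1) / z := by field_simp
    rw [smul_some_eq_ite, e0, e1, div_div_div_cancel_right₀ hz]
    simp [hz]
  | coe z =>
    rw [continuousAt_coe, ContinuousAt]
    simp only [Function.comp_def, smul_some_eq_ite]
    refine tendsto_ite_div (Continuous.tendsto (by fun_prop) z) (Continuous.tendsto (by fun_prop) z)
      fun h h' => hdet ?_
    have h1 : M 1 1 = -(M 1 0 * z) := by linear_combination h
    have h2 : M 0 1 = -(M 0 0 * z) := by linear_combination h'
    rw [h1, h2]; ring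

end OnePoint

/-! ### Connectedness, fibres and deck transformations. -/

/-- The complement of a finite subset of the Riemann sphere is connected. -/
lemma isPreconnected_compl_finset (S : Finset (OnePoint ℂ)) :
    IsPreconnected ((S : Set (OnePoint ℂ))ᶜ) := by
  have hfin : (((↑) : ℂ → OnePoint ℂ) ⁻¹' (S : Set (OnePoint ℂ))).Finite :=
    S.finite_toSet.preimage (OnePoint.coe_injective.injOn)
  have h1 : IsPreconnected ((((↑) : ℂ → OnePoint ℂ) ⁻¹' (S : Set (OnePoint ℂ)))ᶜ) :=
    (hfin.countable.isConnected_compl_of_one_lt_rank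
      (by rw [Complex.rank_real_complex]; exact Nat.one_lt_ofNat)).isPreconnected
  -- The finite points of the complement form a connected set, and the complement lies between that
  -- set and its closure.
  refine (h1.image _ OnePoint.continuous_coe.continuousOn).subset_closure ?_ ?_
  · rintro _ ⟨z, hz, rfl⟩
    exact hz
  · have hd := dense_univ.sdiff_finite (S.finite_toSet.union (Set.finite_singleton ∞))
    refine fun p _ => closure_mono ?_ (hd p)
    intro q hq
    simp only [Set.mem_sdiff, Set.mem_univ, true_and, Set.mem_union,
      Set.mem_singleton_iff, not_or] at hq
    exact ⟨affineCoord q, by simpa [coe_affineCoord hq.2] using hq.1, coe_affineCoord hq.2⟩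

/-- A covering of a connected space by a nonempty space is surjective. -/
theorem IsCoveringMap.surjective_of_preconnectedSpace {E X : Type*} [TopologicalSpace E]
    [TopologicalSpace X] [PreconnectedSpace X] [Nonempty E] {f : E → X} (hf : IsCoveringMap f) :
    Function.Surjective f := by
  have hopen : IsOpen (Set.range f) := hf.isOpenMap.isOpen_range
  have hclosed : IsClosed (Set.range f) := by
    rw [← isOpen_compl_iff, isOpen_iff_mem_nhds]
    intro x hx
    obtain ⟨-, U, hxU, hU, -, H, hH⟩ := hf x
    refine mem_of_superset (hU.mem_nhds hxU) ?_
    rintro y hy ⟨e, rfl⟩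
    -- The fibre coordinate of the trivialization is itself a point of the fibre over `x`, so this
    -- fibre is nonempty.
    let p := (H ⟨e, hy⟩).2
    have hp := hH (H.symm (⟨x, hxU⟩, p))
    rw [H.apply_symm_apply] at hp
    exact hx ⟨_, p.2⟩
  have := IsClopen.eq_univ ⟨hclosed, hopen⟩ (Set.range_nonempty f)
  exact Set.range_eq_univ.mp this

/-- The deck transformations of a simply connected covering act transitively on the fibres. -/
theorem IsCoveringMap.exists_homeomorph_of_eq {E X : Type*} [TopologicalSpace E]
    [TopologicalSpace X] [SimplyConnectedSpace E] [LocallyPathConnectedSpace E] {f : E → X}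
    (hf : IsCoveringMap f) {a b : E} (hab : f a = f b) :
    ∃ h : E ≃ₜ E, (∀ e, f (h e) = f e) ∧ h a = b := by
  obtain ⟨F, ⟨hF, hF'⟩, -⟩ := hf.existsUnique_continuousMap_lifts ⟨f, hf.continuous⟩ a b hab.symm
  obtain ⟨G, ⟨hG, hG'⟩, -⟩ := hf.existsUnique_continuousMap_lifts ⟨f, hf.continuous⟩ b a hab
  have hF1 : ∀ e, f (F e) = f e := fun e => congrFun hF' e
  have hG1 : ∀ e, f (G e) = f e := fun e => congrFun hG' e
  -- `F` and `G` lift `f` through itself; uniqueness of lifts makes them mutually inverse.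
  have h1 : G ∘ F = id := hf.eq_of_comp_eq (G.continuous.comp F.continuous) continuous_id
    (by funext e; simp [hF1, hG1]) a (by simp [hF, hG])
  have h2 : F ∘ G = id := hf.eq_of_comp_eq (F.continuous.comp G.continuous) continuous_id
    (by funext e; simp [hF1, hG1]) b (by simp [hF, hG])
  exact ⟨⟨⟨F, G, congrFun h1, congrFun h2⟩, F.continuous, G.continuous⟩, hF1, hF⟩

namespace IsPuncturedSphereCovering

variable {N : ℕ} {S : Finset (OnePoint ℂ)} {f : ℍ → ↥((S : Set (OnePoint ℂ))ᶜ)}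

lemma surjective (hf : IsPuncturedSphereCovering N S f) : Function.Surjective f := by
  have : PreconnectedSpace ↥((S : Set (OnePoint ℂ))ᶜ) :=
    Subtype.preconnectedSpace (isPreconnected_compl_finset S)
  exact hf.isUniversalCovering.2.surjective_of_preconnectedSpace

lemma exists_eq (hf : IsPuncturedSphereCovering N S f) {p : OnePoint ℂ} (hp : p ∉ S) :
    ∃ τ, (f τ : OnePoint ℂ) = p := by
  obtain ⟨τ, hτ⟩ := hf.surjective ⟨p, hp⟩
  exact ⟨τ, by rw [hτ]⟩

lemma apply_notMem (_ : IsPuncturedSphereCovering N S f) (τ : ℍ) : (f τ : OnePoint ℂ) ∉ S :=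
  (f τ).2

lemma apply_ne_zero (hf : IsPuncturedSphereCovering N S f) (τ : ℍ) :
    (f τ : OnePoint ℂ) ≠ ((0 : ℂ) : OnePoint ℂ) :=
  fun h => hf.apply_notMem τ (h ▸ hf.zero_mem)

/-- The fibres of `f` are the orbits of `Γ(N)`. -/
lemma apply_eq_iff (hf : IsPuncturedSphereCovering N S f) {τ σ : ℍ} :
    (f τ : OnePoint ℂ) = f σ ↔ ∃ γ ∈ CongruenceSubgroup.Gamma N, σ = γ • τ := by
  rw [← Subtype.ext_iff]
  constructor
  · intro h
    obtain ⟨φ, hφ, hτ⟩ := hf.isUniversalCovering.2.exists_homeomorph_of_eq h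
    obtain ⟨γ, hγ, hγφ⟩ := (hf.deckGroup φ).mp hφ
    exact ⟨γ, hγ, by rw [← hτ, hγφ]⟩
  · rintro ⟨γ, hγ, rfl⟩
    have := (hf.deckGroup (Homeomorph.smul (γ : GL (Fin 2) ℝ))).mpr ⟨γ, hγ, fun τ => rfl⟩ τ
    exact this.symm

lemma apply_smul (hf : IsPuncturedSphereCovering N S f) {γ : SL(2, ℤ)}
    (hγ : γ ∈ CongruenceSubgroup.Gamma N) (τ : ℍ) : (f (γ • τ) : OnePoint ℂ) = f τ :=
  (hf.apply_eq_iff.mpr ⟨γ, hγ, rfl⟩).symm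

lemma isOpenMap_coe (hf : IsPuncturedSphereCovering N S f) :
    IsOpenMap (fun τ => (f τ : OnePoint ℂ)) :=
  (S.finite_toSet.isClosed.isOpen_compl.isOpenMap_subtype_val).comp
    hf.isUniversalCovering.2.isOpenMap

lemma exists_nhds_injOn (hf : IsPuncturedSphereCovering N S f) (τ : ℍ) :
    ∃ U ∈ 𝓝 τ, Set.InjOn (fun τ => (f τ : OnePoint ℂ)) U := by
  obtain ⟨e, he, rfl⟩ := hf.isUniversalCovering.2.isLocalHomeomorph τ
  exact ⟨e.source, e.open_source.mem_nhds he, Subtype.val_injective.comp_injOn e.injOn⟩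

end IsPuncturedSphereCovering

/-! ### Holomorphic maps from the upper half-plane to the sphere. -/

lemma UpperHalfPlane.tendsto_ofComplex_nhds (τ : ℍ) : Tendsto ofComplex (𝓝 (τ : ℂ)) (𝓝 τ) := by
  have := (mdifferentiableAt_ofComplex τ.im_pos).continuousAt.tendsto
  rwa [ofComplex_apply] at this

lemma UpperHalfPlane.eventually_nhds_coe {p : ℍ → Prop} {τ : ℍ} (h : ∀ᶠ σ in 𝓝 τ, p σ) :
    ∀ᶠ z in 𝓝 (τ : ℂ), p (ofComplex z) ∧ (ofComplex z : ℂ) = z := by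
  filter_upwards [tendsto_ofComplex_nhds τ h, isOpen_upperHalfPlaneSet.mem_nhds τ.im_pos] with z hz hz'
  exact ⟨hz, by rw [ofComplex_apply_of_im_pos hz']⟩

/-- The coordinate `1 / (z - c)` of the Riemann sphere, a chart on the complement of `c`. -/
def invSubCoord (c : ℂ) : OnePoint ℂ → ℂ
  | ∞ => 0
  | (z : ℂ) => (z - c)⁻¹

@[simp] lemma invSubCoord_infty (c : ℂ) : invSubCoord c ∞ = 0 := rfl

@[simp] lemma invSubCoord_coe (c z : ℂ) : invSubCoord c (z : OnePoint ℂ) = (z - c)⁻¹ := rfl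

namespace IsHolomorphicToSphere

variable {F : ℍ → OnePoint ℂ}

lemma eventually_ne (hF : IsHolomorphicToSphere F) {τ : ℍ} {p : OnePoint ℂ} (h : F τ ≠ p) :
    ∀ᶠ σ in 𝓝 τ, F σ ≠ p :=
  hF.1.continuousAt.eventually_ne h

lemma differentiableAt (hF : IsHolomorphicToSphere F) {τ : ℍ} (h : F τ ≠ ∞) :
    DifferentiableAt ℂ (fun z => affineCoord (F (ofComplex z))) τ :=
  mdifferentiableAt_iff.mp ((hF.2 τ).1 h)

lemma analyticAt (hF : IsHolomorphicToSphere F) {τ : ℍ} (h : F τ ≠ ∞) :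
    AnalyticAt ℂ (fun z => affineCoord (F (ofComplex z))) τ := by
  rw [Complex.analyticAt_iff_eventually_differentiableAt]
  filter_upwards [eventually_nhds_coe (hF.eventually_ne h)] with z hz
  have := hF.differentiableAt hz.1
  rwa [hz.2] at this

/-- A covering is only topologically a local homeomorphism. Nonvanishing of the derivative gives
holomorphic local sections, and later makes a pole simple. -/
lemma deriv_ne_zero (hF : IsHolomorphicToSphere F) {τ : ℍ} (h : F τ ≠ ∞) {U : Set ℍ}
    (hU : U ∈ 𝓝 τ) (hinj : Set.InjOn F U) :
    deriv (fun z => affineCoord (F (ofComplex z))) τ ≠ 0 := by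
  refine (hF.analyticAt h).deriv_ne_zero_of_injOn
    (eventually_nhds_coe ((eventually_mem_set.mpr hU).and (hF.eventually_ne h))) ?_
  rintro z ⟨⟨h1, h2⟩, h3⟩ w ⟨⟨h4, h5⟩, h6⟩ hzw
  simp only at hzw
  rw [affineCoord_eq_iff h2, coe_affineCoord h5] at hzw
  rw [← h3, ← h6, hinj h1 h4 hzw]

/-- The coordinate `1 / (z - c)` on the sphere composed with a holomorphic map is holomorphic
away from the fibre over `c`. -/
lemma differentiableAt_inv_sub (hF : IsHolomorphicToSphere F) {τ : ℍ} {c : ℂ}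
    (h : F τ ≠ (c : OnePoint ℂ)) :
    DifferentiableAt ℂ (fun z => invSubCoord c (F (ofComplex z))) τ := by
  by_cases hinf : F τ = ∞
  · have h0 : F τ ≠ ((0 : ℂ) : OnePoint ℂ) := by rw [hinf]; exact infty_ne_coe _
    have h1 := mdifferentiableAt_iff.mp ((hF.2 τ).2 h0)
    have h2 : coordAtInfty (F τ) = 0 := by rw [hinf]; rfl
    -- With `t = 1 / z` one has `1 / (z - c) = t / (1 - c * t)`, which is regular at `t = 0`.
    have h3 : DifferentiableAt ℂ (fun z => coordAtInfty (F (ofComplex z)) /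
        (1 - c * coordAtInfty (F (ofComplex z)))) (τ : ℂ) := by
      refine DifferentiableAt.div h1 ((differentiableAt_const _).sub (h1.const_mul c)) ?_
      simp [h2]
    refine h3.congr_of_eventuallyEq ?_
    filter_upwards [eventually_nhds_coe (hF.eventually_ne h0)] with z hz
    have hz := hz.1
    induction hp : F (ofComplex z) using OnePoint.rec with
    | infty => simp
    | coe w =>
      have hw : w ≠ 0 := by rintro rfl; exact hz hp
      rw [invSubCoord_coe, coordAtInfty_coe]
      field_simp
  · have h1 := hF.differentiableAt hinf
    have h3 : DifferentiableAt ℂ (fun z => (affineCoord (F (ofComplex z)) - c)⁻¹) (τ : ℂ) := by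
      refine (h1.sub_const c).inv ?_
      rw [ofComplex_apply, sub_ne_zero, Ne, affineCoord_eq_iff hinf]
      exact h
    refine h3.congr_of_eventuallyEq ?_
    filter_upwards [eventually_nhds_coe (hF.eventually_ne hinf)] with z hz
    rw [← invSubCoord_coe, coe_affineCoord hz.1]

/-- A locally injective holomorphic map to the sphere has holomorphic local sections. -/
lemma exists_local_section (hF : IsHolomorphicToSphere F) {τ : ℍ} {w : ℂ} (hτ : F τ = w)
    {U : Set ℍ} (hU : U ∈ 𝓝 τ) (hinj : Set.InjOn F U) :
    ∃ σ : ℂ → ℂ, AnalyticAt ℂ σ w ∧ σ w = τ ∧ deriv σ w ≠ 0 ∧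
      ∀ᶠ z in 𝓝 w, F (ofComplex (σ z)) = z := by
  have hinf : F τ ≠ ∞ := by rw [hτ]; exact coe_ne_infty _
  have ha := hF.analyticAt hinf
  have hd := hF.deriv_ne_zero hinf hU hinj
  set φ : ℂ → ℂ := fun z => affineCoord (F (ofComplex z)) with hφ
  have hw : φ τ = w := by simp [hφ, hτ]
  have hs := ha.hasStrictDerivAt
  have hr : AnalyticAt ℂ (hs.localInverse φ _ τ hd) w := hw ▸ ha.analyticAt_localInverse hd
  have hval : hs.localInverse φ _ τ hd w = τ := by
    rw [← hw]; exact (hs.hasStrictFDerivAt_equiv hd).localInverse_apply_image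
  have hder : HasStrictDerivAt (hs.localInverse φ _ τ hd) (deriv φ τ)⁻¹ w := by
    have := hs.to_localInverse hd
    rwa [hw] at this
  have hright : ∀ᶠ z in 𝓝 w, φ (hs.localInverse φ _ τ hd z) = z :=
    hw ▸ (hs.hasStrictFDerivAt_equiv hd).eventually_right_inverse
  refine ⟨hs.localInverse φ _ τ hd, hr, hval, ?_, ?_⟩
  · rw [hder.hasDerivAt.deriv]
    exact inv_ne_zero hd
  · have ht := hr.continuousAt.tendsto
    rw [hval] at ht
    filter_upwards [hright, ht (eventually_nhds_coe (hF.eventually_ne hinf))] with z h1 h2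
    exact (affineCoord_eq_iff h2.1).mp h1

end IsHolomorphicToSphere

/-! ### Maps with equal fibres differ by a Möbius transformation. -/

/-- Two holomorphic maps to the sphere with the same fibres, both open and locally injective,
the first one onto the complement of a finite set, differ by a Möbius transformation. -/
theorem exists_gl_smul_eq {F G : ℍ → OnePoint ℂ} (hF : IsHolomorphicToSphere F)
    (hG : IsHolomorphicToSphere G) (hFo : IsOpenMap F) (hGo : IsOpenMap G)
    (hFi : ∀ τ, ∃ U ∈ 𝓝 τ, Set.InjOn F U) (hGi : ∀ τ, ∃ U ∈ 𝓝 τ, Set.InjOn G U)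
    (hfib : ∀ τ σ, F τ = F σ ↔ G τ = G σ) (S : Finset (OnePoint ℂ))
    (hsurj : ∀ p ∉ S, ∃ τ, F τ = p) (hS : ∀ τ, F τ ∉ S) {τ₀ : ℍ} (hF0 : F τ₀ ≠ ∞)
    (hG0 : G τ₀ ≠ ∞) : ∃ M : GL (Fin 2) ℂ, ∀ τ, G τ = M • F τ := by
  classical
  obtain ⟨w₀, hw₀⟩ := OnePoint.ne_infty_iff_exists.mp hF0
  obtain ⟨c, hc⟩ := OnePoint.ne_infty_iff_exists.mp hG0
  set s : Finset ℂ := S.preimage ((↑) : ℂ → OnePoint ℂ) OnePoint.coe_injective.injOn with hs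
  have hmem : ∀ w : ℂ, w ∈ s ↔ (w : OnePoint ℂ) ∈ S := fun w => by simp [hs]
  have hsurj' : ∀ w ∉ s, ∃ τ, F τ = (w : OnePoint ℂ) := fun w hw => hsurj _ (by rwa [← hmem])
  -- This is `1 / (G ∘ F⁻¹ - c)`, independent of the chosen preimage because the fibres agree. The
  -- default `∞` concerns only punctures, where the value of `ψ` plays no role.
  set ψ : ℂ → ℂ := fun w =>
    invSubCoord c (if h : ∃ τ, F τ = (w : OnePoint ℂ) then G h.choose else ∞) with hψdef
  have hψ : ∀ (τ : ℍ) (w : ℂ), F τ = w → ψ w = invSubCoord c (G τ) := by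
    intro τ w h
    have hex : ∃ τ, F τ = (w : OnePoint ℂ) := ⟨τ, h⟩
    simp only [hψdef, dif_pos hex]
    rw [(hfib _ _).mp (hex.choose_spec.trans h.symm)]
  have hGc : ∀ τ, G τ = c ↔ F τ = w₀ := by
    intro τ
    rw [hc, hw₀]
    exact (hfib _ _).symm
  have hdiff : ∀ w ∉ s, w ≠ w₀ → DifferentiableAt ℂ ψ w := by
    intro w hw hne
    obtain ⟨τ, hτ⟩ := hsurj' w hw
    obtain ⟨U, hU, hinj⟩ := hFi τ
    obtain ⟨σ, hσa, hσw, -, hσ⟩ := hF.exists_local_section hτ hU hinj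
    have hGτ : G τ ≠ c := by
      rw [Ne, hGc, hτ, OnePoint.coe_eq_coe]
      exact hne
    have h1 := hG.differentiableAt_inv_sub hGτ
    rw [← hσw] at h1
    refine (h1.comp w hσa.differentiableAt).congr_of_eventuallyEq ?_
    filter_upwards [hσ] with z hz
    exact hψ _ _ hz
  -- `G` is open, so `G (F⁻¹ U)` contains a ball about `c`. A point outside `U` cannot have its
  -- `G`-value in that ball, since equal `G`-values force equal `F`-values.
  have hbdd : ∀ U ∈ 𝓝 w₀, ∃ K, ∀ w ∉ U, w ∉ s → ‖ψ w‖ ≤ K := by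
    intro U hU
    have h1 : ((↑) : ℂ → OnePoint ℂ) '' U ∈ 𝓝 (F τ₀) := by
      rw [← hw₀]
      exact OnePoint.isOpenEmbedding_coe.isOpenMap.image_mem_nhds hU
    have h2 : G '' (F ⁻¹' (((↑) : ℂ → OnePoint ℂ) '' U)) ∈ 𝓝 (c : OnePoint ℂ) := by
      rw [hc]
      exact hGo.image_mem_nhds (hF.1.continuousAt h1)
    have h3 := (OnePoint.continuous_coe.tendsto c) h2
    obtain ⟨ε, hε, hball⟩ := Metric.mem_nhds_iff.mp h3
    refine ⟨ε⁻¹, fun w hwU hws => ?_⟩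
    obtain ⟨τ, hτ⟩ := hsurj' w hws
    rw [hψ τ w hτ]
    induction hp : G τ using OnePoint.rec with
    | infty => simpa using hε.le
    | coe z =>
      rw [invSubCoord_coe, norm_inv]
      refine inv_anti₀ hε ?_
      by_contra hlt
      have hz : z ∈ Metric.ball c ε := by rw [mem_ball_iff_norm]; exact not_le.mp hlt
      obtain ⟨σ, ⟨w', hw', hσ⟩, hGσ⟩ := hball hz
      have h4 : F σ = F τ := (hfib _ _).mpr (hGσ.trans hp.symm)
      rw [hτ, ← hσ, OnePoint.coe_eq_coe] at h4
      exact hwU (h4 ▸ hw')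
  obtain ⟨U, hU, hinj⟩ := hFi τ₀
  obtain ⟨V, hV, hinjV⟩ := hGi τ₀
  obtain ⟨σ, hσa, hσw, hσd, hσ⟩ := hF.exists_local_section hw₀.symm hU hinj
  have hga := hG.analyticAt hG0
  have hgd := hG.deriv_ne_zero hG0 hV hinjV
  set g : ℂ → ℂ := fun z => affineCoord (G (ofComplex z)) with hg
  have hgσ : AnalyticAt ℂ g (σ w₀) := hσw ▸ hga
  have hφa : AnalyticAt ℂ (fun w => g (σ w) - c) w₀ := (hgσ.comp hσa).sub analyticAt_const
  have hφ0 : g (σ w₀) - c = 0 := by rw [hσw, hg]; simp [← hc]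
  have hφd : deriv (fun w => g (σ w) - c) w₀ ≠ 0 := by
    have h1 : HasDerivAt (fun w => g (σ w) - c) (deriv g (σ w₀) * deriv σ w₀) w₀ :=
      (hgσ.differentiableAt.hasDerivAt.comp w₀ hσa.differentiableAt.hasDerivAt).sub_const c
    rw [h1.deriv, hσw]
    exact mul_ne_zero hgd hσd
  have hψφ : ∀ᶠ w in 𝓝[≠] w₀, ψ w = (g (σ w) - c)⁻¹ := by
    refine nhdsWithin_le_nhds ?_
    have ht := hσa.continuousAt.tendsto
    rw [hσw] at ht
    filter_upwards [hσ, ht (eventually_nhds_coe (hG.eventually_ne hG0))] with w h1 h2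
    rw [hψ _ _ h1, ← invSubCoord_coe, coe_affineCoord h2.1]
  obtain ⟨α, β, hβ, hαβ⟩ := exists_eq_add_div_of_simple_pole s w₀ ψ _ hdiff hbdd hφa hφ0 hφd hψφ
  -- Solving `1 / (G - c) = α + β / (w - w₀)` gives `G = c + (w - w₀) / (α * (w - w₀) + β)`; the
  -- determinant is `β`.
  set A : Matrix (Fin 2) (Fin 2) ℂ :=
    !![c * α + 1, c * β - (c * α + 1) * w₀; α, β - α * w₀] with hA
  have hdet : A.det ≠ 0 := by
    rw [hA, Matrix.det_fin_two_of]
    convert hβ using 1; ring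
  refine ⟨Matrix.GeneralLinearGroup.mkOfDetNeZero A hdet, ?_⟩
  set M := Matrix.GeneralLinearGroup.mkOfDetNeZero A hdet with hM
  have hM00 : M 0 0 = c * α + 1 := rfl
  have hM01 : M 0 1 = c * β - (c * α + 1) * w₀ := rfl
  have hM10 : M 1 0 = α := rfl
  have hM11 : M 1 1 = β - α * w₀ := rfl
  -- The formula is checked only where `F` avoids `∞` and `w₀`. Preimages of dense sets under the
  -- open map `F` are dense, so continuity gives the rest.
  have hdense : Dense {τ | F τ ≠ ∞ ∧ F τ ≠ (w₀ : OnePoint ℂ)} := by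
    have h1 := (dense_univ (X := OnePoint ℂ)).sdiff_finite
      ((Set.finite_singleton (w₀ : OnePoint ℂ)).insert ∞)
    refine (h1.preimage hFo).mono ?_
    intro τ hτ
    simpa [not_or] using hτ
  have hclosed : IsClosed {τ | G τ = M • F τ} :=
    isClosed_eq hG.1 ((OnePoint.continuous_gl_smul M).comp hF.1)
  suffices h : {τ | F τ ≠ ∞ ∧ F τ ≠ (w₀ : OnePoint ℂ)} ⊆ {τ | G τ = M • F τ} from
    fun τ => (hclosed.closure_subset_iff.mpr h) (hdense τ)
  rintro τ ⟨h1, h2⟩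
  obtain ⟨w, hw⟩ := OnePoint.ne_infty_iff_exists.mp h1
  rw [← hw, Ne, OnePoint.coe_eq_coe] at h2
  have h3 := hαβ w (fun h => hS τ (hw ▸ (hmem w).mp h)) h2
  rw [hψ τ w hw.symm] at h3
  have h4 : w - w₀ ≠ 0 := sub_ne_zero.mpr h2
  have h5 : G τ ≠ c := by
    rw [Ne, hGc, ← hw, OnePoint.coe_eq_coe]
    exact h2
  change G τ = M • F τ
  rw [← hw, smul_some_eq_ite, hM00, hM01, hM10, hM11]
  induction hp : G τ using OnePoint.rec with
  | infty =>
    rw [hp, invSubCoord_infty] at h3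
    rw [if_pos]
    field_simp at h3
    linear_combination -h3
  | coe z =>
    rw [hp, invSubCoord_coe] at h3
    have h6 : z - c ≠ 0 := by
      rw [sub_ne_zero]; rintro rfl; exact h5 hp
    have h7 : (α * (w - w₀) + β) * (z - c) = w - w₀ := by
      field_simp at h3
      linear_combination -h3
    have h8 : α * w + (β - α * w₀) ≠ 0 := by
      intro h
      apply h4
      rw [← h7]
      linear_combination (z - c) * h
    rw [if_neg h8, OnePoint.coe_eq_coe, eq_div_iff h8]
    linear_combination h7

/-! ### Taylor coefficients and the recursion for `u a / (1 + v a)`. -/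

/-- The Taylor coefficients at `0`. -/
def taylorCoeff (φ : ℂ → ℂ) (n : ℕ) : ℂ := (n.factorial : ℂ)⁻¹ * iteratedDeriv n φ 0

@[simp] lemma taylorCoeff_zero (φ : ℂ → ℂ) : taylorCoeff φ 0 = φ 0 := by simp [taylorCoeff]

@[simp] lemma taylorCoeff_one (φ : ℂ → ℂ) : taylorCoeff φ 1 = deriv φ 0 := by simp [taylorCoeff]

lemma DifferentiableOn.hasSum_taylorCoeff {φ : ℂ → ℂ} {r : ℝ}
    (hφ : DifferentiableOn ℂ φ (Metric.ball 0 r)) {q : ℂ} (hq : q ∈ Metric.ball 0 r) :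
    HasSum (fun n => taylorCoeff φ n * q ^ n) (φ q) := by
  convert! Complex.hasSum_taylorSeries_on_ball hφ hq using 2 with n
  simp only [taylorCoeff, sub_zero, smul_eq_mul]
  ring

lemma AnalyticAt.eventually_hasSum_taylorCoeff {φ : ℂ → ℂ} (hφ : AnalyticAt ℂ φ 0) :
    ∀ᶠ q in 𝓝 0, HasSum (fun n => taylorCoeff φ n * q ^ n) (φ q) := by
  obtain ⟨s, hs, hd⟩ := hφ.eventually_analyticAt.exists_mem
  obtain ⟨r, hr, hrs⟩ := Metric.mem_nhds_iff.mp hs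
  have h : DifferentiableOn ℂ φ (Metric.ball 0 r) := fun z hz =>
    (hd z (hrs hz)).differentiableAt.differentiableWithinAt
  filter_upwards [Metric.ball_mem_nhds 0 hr] with q hq using h.hasSum_taylorCoeff hq

/-- The coefficients of a power series expansion are the Taylor coefficients. -/
lemma AnalyticAt.eq_taylorCoeff {φ : ℂ → ℂ} (hφ : AnalyticAt ℂ φ 0) {e : ℕ → ℂ}
    (he : ∀ᶠ q in 𝓝 0, HasSum (fun n => e n * q ^ n) (φ q)) : e = taylorCoeff φ := by
  have key : ∀ c : ℕ → ℂ, (∀ᶠ q in 𝓝 0, HasSum (fun n => c n * q ^ n) (φ q)) →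
      HasFPowerSeriesAt φ (FormalMultilinearSeries.ofScalars ℂ c) 0 := by
    intro c hc
    rw [hasFPowerSeriesAt_iff]
    filter_upwards [hc] with q hq
    simpa [FormalMultilinearSeries.coeff_ofScalars, mul_comm] using hq
  exact FormalMultilinearSeries.ofScalars_series_injective ℂ ℂ
    ((key _ he).eq_formalMultilinearSeries (key _ hφ.eventually_hasSum_taylorCoeff))

lemma taylorCoeff_congr {φ χ : ℂ → ℂ} (h : φ =ᶠ[𝓝 0] χ) : taylorCoeff φ = taylorCoeff χ := by
  funext n
  rw [taylorCoeff, taylorCoeff, h.iteratedDeriv_eq n]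

lemma taylorCoeff_mul {φ χ : ℂ → ℂ} (hφ : AnalyticAt ℂ φ 0) (hχ : AnalyticAt ℂ χ 0) (n : ℕ) :
    taylorCoeff (φ * χ) n =
      ∑ i ∈ Finset.range (n + 1), taylorCoeff φ i * taylorCoeff χ (n - i) := by
  rw [taylorCoeff, iteratedDeriv_mul hφ.contDiffAt hχ.contDiffAt, Finset.mul_sum]
  refine Finset.sum_congr rfl fun i hi => ?_
  have hi : i ≤ n := by simpa [Nat.lt_succ_iff] using hi
  have h := Nat.choose_mul_factorial_mul_factorial hi
  have h' : (n.choose i : ℂ) * i.factorial * (n - i).factorial = n.factorial := by exact_mod_cast h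
  have h1 : (i.factorial : ℂ) ≠ 0 := by exact_mod_cast i.factorial_ne_zero
  have h2 : ((n - i).factorial : ℂ) ≠ 0 := by exact_mod_cast (n - i).factorial_ne_zero
  have h3 : (n.factorial : ℂ) ≠ 0 := by exact_mod_cast n.factorial_ne_zero
  simp only [taylorCoeff]
  rw [← h']
  have h4 : (n.choose i : ℂ) ≠ 0 := by exact_mod_cast (Nat.choose_pos hi).ne'
  field_simp

lemma taylorCoeff_add {φ χ : ℂ → ℂ} (hφ : AnalyticAt ℂ φ 0) (hχ : AnalyticAt ℂ χ 0) (n : ℕ) :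
    taylorCoeff (φ + χ) n = taylorCoeff φ n + taylorCoeff χ n := by
  simp only [taylorCoeff]
  rw [iteratedDeriv_add hφ.contDiffAt hχ.contDiffAt, mul_add]

lemma taylorCoeff_const_mul (u : ℂ) (φ : ℂ → ℂ) (n : ℕ) :
    taylorCoeff (fun z => u * φ z) n = u * taylorCoeff φ n := by
  simp only [taylorCoeff]
  rw [iteratedDeriv_const_mul_field]
  ring

/-- The coefficients of `b = u a / (1 + v a)` are `u` times polynomials in `v`. -/
lemma exists_polynomial_coeff (a : ℕ → ℂ) (ha : a 0 = 0) (n : ℕ) :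
    ∃ p : Polynomial ℂ, ∀ (u v : ℂ) (b : ℕ → ℂ),
      (∀ n, b n + v * ∑ i ∈ Finset.range (n + 1), b i * a (n - i) = u * a n) →
      b n = u * p.eval v := by
  induction n using Nat.strong_induction_on with
  | _ n ih =>
    choose! p hp using ih
    refine ⟨Polynomial.C (a n) -
      Polynomial.X * ∑ i ∈ Finset.range n, p i * Polynomial.C (a (n - i)), fun u v b hb => ?_⟩
    have h := hb n
    -- The term `i = n` carries the factor `a 0 = 0`, so the relation expresses `b n` through
    -- earlier coefficients.
    rw [Finset.sum_range_succ, Nat.sub_self, ha, mul_zero, add_zero] at h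
    have hsum : ∑ i ∈ Finset.range n, b i * a (n - i) =
        u * ∑ i ∈ Finset.range n, (p i).eval v * a (n - i) := by
      rw [Finset.mul_sum]
      refine Finset.sum_congr rfl fun i hi => ?_
      rw [hp i (Finset.mem_range.mp hi) u v b hb, mul_assoc]
    rw [hsum] at h
    simp only [Polynomial.eval_sub, Polynomial.eval_C, Polynomial.eval_mul, Polynomial.eval_X,
      Polynomial.eval_finsetSum]
    linear_combination h

/-- Splitting off the first terms of a power series without constant term. -/
lemma hasSum_mul_pow_iff {e : ℕ → ℂ} (h0 : e 0 = 0) {q a : ℂ} :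
    HasSum (fun n => e n * q ^ n) a ↔
      HasSum (fun n => e (n + 3) * q ^ (n + 3)) (a - (e 1 * q + e 2 * q ^ 2)) := by
  rw [← hasSum_nat_add_iff' (f := fun n => e n * q ^ n) 3]
  simp [Finset.sum_range_succ, h0]

/-! ### The expansion in `q` at the cusp. -/

/-- The expansion of `F` in `q = exp (2πiτ/N)` at the cusp `∞`, as a function of `q`. -/
def cuspExpansion (N : ℕ) (F : ℍ → OnePoint ℂ) : ℂ → ℂ :=
  Function.Periodic.cuspFunction (N : ℝ) fun z => affineCoord (F (ofComplex z))

lemma qParam_add_int_mul {N : ℕ} (hN : N ≠ 0) (z : ℂ) (k : ℤ) :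
    Function.Periodic.qParam (N : ℝ) (z + N * k) = Function.Periodic.qParam (N : ℝ) z := by
  have hN' : (N : ℂ) ≠ 0 := by exact_mod_cast hN
  simp only [Function.Periodic.qParam, Complex.ofReal_natCast]
  rw [Complex.exp_eq_exp_iff_exists_int]
  exact ⟨k, by field_simp⟩

/-- An element of `Γ(N)` that maps a point of large imaginary part to another such point
is a translation by a multiple of `N`. -/
lemma qParam_smul_of_mem_Gamma {N : ℕ} (hN : N ≠ 0) {γ : SL(2, ℤ)}
    (hγ : γ ∈ CongruenceSubgroup.Gamma N) {τ : ℍ} (h1 : 1 < τ.im) (h2 : 1 < (γ • τ).im) :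
    Function.Periodic.qParam (N : ℝ) (γ • τ : ℍ) = Function.Periodic.qParam (N : ℝ) τ := by
  -- A nonzero lower-left entry `c` gives `|c τ + d| ^ 2 ≥ (Im τ) ^ 2 > Im τ`, hence `Im (γ τ) < 1`.
  have hc : γ 1 0 = 0 := by
    by_contra hc
    have h3 : (((γ 1 0 : ℤ) : ℝ) * τ.im) ^ 2 ≤ Complex.normSq (denom γ τ) := by
      simpa using c_mul_im_sq_le_normSq_denom (γ : GL (Fin 2) ℝ) τ
    have h4 : (γ • τ).im = τ.im / Complex.normSq (denom γ τ) := ModularGroup.im_smul_eq_div_normSq γ τ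
    have h5 : (1 : ℝ) ≤ ((γ 1 0 : ℤ) : ℝ) ^ 2 := by
      exact_mod_cast Int.add_one_le_iff.mpr (sq_pos_of_ne_zero hc)
    have h6 : τ.im ^ 2 ≤ (((γ 1 0 : ℤ) : ℝ) * τ.im) ^ 2 := by
      rw [mul_pow]
      exact le_mul_of_one_le_left (sq_nonneg _) h5
    have h7 : τ.im < τ.im ^ 2 := by nlinarith
    have h8 : τ.im ≤ Complex.normSq (denom γ τ) := by linarith
    rw [h4, lt_div_iff₀ (τ.im_pos.trans_le h8)] at h2
    linarith
  have hdet : γ 0 0 * γ 1 1 = 1 := by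
    have := γ.det_coe
    rw [Matrix.det_fin_two, hc] at this
    simpa using this
  have hb : (N : ℤ) ∣ γ 0 1 := by
    rw [← ZMod.intCast_zmod_eq_zero_iff_dvd]
    exact (CongruenceSubgroup.Gamma_mem.mp hγ).2.1
  obtain ⟨k, hk⟩ := hb
  have hval : ((γ • τ : ℍ) : ℂ) = ((γ 0 0 : ℤ) * (τ : ℂ) + (γ 0 1 : ℤ)) / (γ 1 1 : ℤ) := by
    rw [coe_specialLinearGroup_apply, hc]
    simp
  rcases Int.mul_eq_one_iff_eq_one_or_neg_one.mp hdet with ⟨ha, hd⟩ | ⟨ha, hd⟩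
  · rw [hval, ha, hd, hk, ← qParam_add_int_mul hN τ k]
    congr 1; push_cast; ring
  · rw [hval, ha, hd, hk, ← qParam_add_int_mul hN τ (-k)]
    congr 1; push_cast; ring

namespace IsPuncturedSphereCovering

variable {N : ℕ} {S : Finset (OnePoint ℂ)} {f : ℍ → ↥((S : Set (OnePoint ℂ))ᶜ)}

lemma tendsto_zero (hf : IsPuncturedSphereCovering N S f) :
    Tendsto (fun τ => (f τ : OnePoint ℂ)) atImInfty (𝓝 ((0 : ℂ) : OnePoint ℂ)) := by
  simpa [HasValueAtCusp] using hf.vanishes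

lemma exists_ne_infty (hf : IsPuncturedSphereCovering N S f) :
    ∃ Y : ℝ, ∀ τ : ℍ, Y < τ.im → (f τ : OnePoint ℂ) ≠ ∞ := by
  have h := hf.tendsto_zero.eventually_ne (coe_ne_infty (0 : ℂ))
  obtain ⟨Y, hY⟩ := (atImInfty_mem _).mp h
  exact ⟨Y, fun τ hτ => hY τ hτ.le⟩

lemma periodic (hf : IsPuncturedSphereCovering N S f) :
    Function.Periodic (fun z => affineCoord (f (ofComplex z))) ((N : ℝ) : ℂ) := by
  intro z
  by_cases hz : 0 < z.im
  · have hz' : 0 < (z + ((N : ℝ) : ℂ)).im := by simpa using hz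
    have hT : ModularGroup.T ^ (N : ℤ) ∈ CongruenceSubgroup.Gamma N := by
      simpa using CongruenceSubgroup.ModularGroup_T_pow_mem_Gamma (N : ℤ) N dvd_rfl
    have h : ofComplex (z + ((N : ℝ) : ℂ)) = ModularGroup.T ^ (N : ℤ) • ofComplex z := by
      ext
      rw [ModularGroup.coe_T_zpow_smul_eq, ofComplex_apply_of_im_pos hz,
        ofComplex_apply_of_im_pos hz']
      simp
    simp only [h, hf.apply_smul hT]
  -- Off the upper half-plane `ofComplex` takes a constant default value, so periodicity is trivial
  -- there.
  · have hz' : (z + ((N : ℝ) : ℂ)).im ≤ 0 := by simpa using hz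
    simp only [ofComplex_apply_eq_of_im_nonpos (not_lt.mp hz) hz']

lemma coe_cuspExpansion (hf : IsPuncturedSphereCovering N S f) (hN : N ≠ 0) {τ : ℍ}
    (hτ : (f τ : OnePoint ℂ) ≠ ∞) :
    ((cuspExpansion N (fun τ => f τ) (Function.Periodic.qParam (N : ℝ) τ) : ℂ) : OnePoint ℂ) =
      f τ := by
  rw [cuspExpansion, Function.Periodic.eq_cuspFunction (by exact_mod_cast hN) hf.periodic,
    ofComplex_apply, coe_affineCoord hτ]

lemma zeroAtFilter (hf : IsPuncturedSphereCovering N S f) :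
    ZeroAtFilter (comap Complex.im atTop) (fun z => affineCoord (f (ofComplex z))) := by
  have h1 : Tendsto affineCoord (𝓝 ((0 : ℂ) : OnePoint ℂ)) (𝓝 0) := by
    have := (continuousAt_coe (f := affineCoord) (x := (0 : ℂ))).mpr continuousAt_id
    exact this
  exact h1.comp (hf.tendsto_zero.comp tendsto_comap_im_ofComplex)

lemma cuspExpansion_zero (hf : IsPuncturedSphereCovering N S f) (hN : N ≠ 0) :
    cuspExpansion N (fun τ => f τ) 0 = 0 :=
  Function.Periodic.cuspFunction_zero_of_zero_at_inf (by positivity) hf.zeroAtFilter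

/-- The punctured disc is the image of `Im τ > Y` under `q`, and `q = 0` is removable because `f`
tends to `0`. Holomorphy on the whole disc is what yields convergence on each half-plane without
poles. -/
lemma differentiableOn_cuspExpansion (hf : IsPuncturedSphereCovering N S f) (hN : N ≠ 0) {Y : ℝ}
    (hY0 : 0 ≤ Y) (hY : ∀ τ : ℍ, Y < τ.im → (f τ : OnePoint ℂ) ≠ ∞) :
    DifferentiableOn ℂ (cuspExpansion N (fun τ => f τ))
      (Metric.ball 0 (Real.exp (-2 * Real.pi * Y / N))) := by
  have hN' : (0 : ℝ) < N := by positivity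
  have hd : ∀ z : ℂ, Y < z.im →
      DifferentiableAt ℂ (fun z => affineCoord (f (ofComplex z))) z := by
    intro z hz
    have := hf.isUniversalCovering.1.differentiableAt (hY ⟨z, hY0.trans_lt hz⟩ hz)
    exact this
  intro q hq
  refine DifferentiableAt.differentiableWithinAt ?_
  by_cases h0 : q = 0
  · rw [h0]
    refine Function.Periodic.differentiableAt_cuspFunction_zero hN' hf.periodic ?_
      hf.zeroAtFilter.boundedAtFilter
    exact (tendsto_comap.eventually (eventually_gt_atTop Y)).mono hd
  · rw [← Function.Periodic.qParam_right_inv hN'.ne' h0] at hq ⊢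
    refine Function.Periodic.differentiableAt_cuspFunction hN'.ne' hf.periodic (hd _ ?_)
    rw [mem_ball_zero_iff] at hq
    exact (Function.Periodic.norm_qParam_lt_iff hN' Y _).mp hq

lemma analyticAt_cuspExpansion (hf : IsPuncturedSphereCovering N S f) (hN : N ≠ 0) :
    AnalyticAt ℂ (cuspExpansion N (fun τ => f τ)) 0 := by
  obtain ⟨Y, hY⟩ := hf.exists_ne_infty
  exact (hf.differentiableOn_cuspExpansion hN (le_max_right Y 0)
    fun τ hτ => hY τ ((le_max_left _ _).trans_lt hτ)).analyticAt
    (Metric.ball_mem_nhds _ (Real.exp_pos _))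

end IsPuncturedSphereCovering

lemma eventually_exists_qParam_eq {N : ℕ} (hN : N ≠ 0) (Y : ℝ) :
    ∀ᶠ q in 𝓝[≠] (0 : ℂ), ∃ τ : ℍ, Y < τ.im ∧ Function.Periodic.qParam (N : ℝ) τ = q := by
  have hN' : (0 : ℝ) < N := by positivity
  have h := (Function.Periodic.invQParam_tendsto hN').eventually
    (tendsto_comap.eventually (eventually_gt_atTop (max Y 0)))
  filter_upwards [h, self_mem_nhdsWithin] with q hq hq0
  exact ⟨⟨_, (le_max_right _ _).trans_lt hq⟩, (le_max_left _ _).trans_lt hq,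
    Function.Periodic.qParam_right_inv hN'.ne' hq0⟩

namespace IsPuncturedSphereCovering

variable {N : ℕ} {S : Finset (OnePoint ℂ)} {f : ℍ → ↥((S : Set (OnePoint ℂ))ᶜ)}

/-- The expansion is injective near `0`: high points with equal values are `Γ(N)`-equivalent, hence
have equal `q`; and the value `0` at `q = 0` is not taken elsewhere, because `0` is a puncture. -/
lemma deriv_cuspExpansion_ne_zero (hf : IsPuncturedSphereCovering N S f) (hN : N ≠ 0) :
    deriv (cuspExpansion N (fun τ => f τ)) 0 ≠ 0 := by
  obtain ⟨Y, hY⟩ := hf.exists_ne_infty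
  have hev := eventually_exists_qParam_eq hN (max Y 1)
  rw [eventually_nhdsWithin_iff] at hev
  have hne : ∀ τ : ℍ, max Y 1 < τ.im →
      cuspExpansion N (fun τ => f τ) (Function.Periodic.qParam (N : ℝ) τ) ≠ 0 := by
    intro τ hτ h
    have := hf.coe_cuspExpansion hN (hY τ ((le_max_left _ _).trans_lt hτ))
    rw [h] at this
    exact hf.apply_ne_zero τ this.symm
  refine (hf.analyticAt_cuspExpansion hN).deriv_ne_zero_of_injOn hev ?_
  intro q hq q' hq' heq
  by_cases h0 : q = 0 <;> by_cases h0' : q' = 0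
  · rw [h0, h0']
  · obtain ⟨τ, hτ, rfl⟩ := hq' h0'
    rw [h0, hf.cuspExpansion_zero hN] at heq
    exact absurd heq.symm (hne τ hτ)
  · obtain ⟨τ, hτ, rfl⟩ := hq h0
    rw [h0', hf.cuspExpansion_zero hN] at heq
    exact absurd heq (hne τ hτ)
  · obtain ⟨τ, hτ, rfl⟩ := hq h0
    obtain ⟨σ, hσ, rfl⟩ := hq' h0'
    have h1 := hf.coe_cuspExpansion hN (hY τ ((le_max_left _ _).trans_lt hτ))
    rw [heq, hf.coe_cuspExpansion hN (hY σ ((le_max_left _ _).trans_lt hσ))] at h1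
    obtain ⟨γ, hγ, rfl⟩ := hf.apply_eq_iff.mp h1.symm
    exact (qParam_smul_of_mem_Gamma hN hγ ((le_max_right _ _).trans_lt hτ)
      ((le_max_right _ _).trans_lt hσ)).symm

/-- The Taylor coefficients of `f` in `q`. -/
abbrev coeff (_ : IsPuncturedSphereCovering N S f) : ℕ → ℂ :=
  taylorCoeff (cuspExpansion N (fun τ => f τ))

lemma coeff_zero (hf : IsPuncturedSphereCovering N S f) (hN : N ≠ 0) : hf.coeff 0 = 0 := by
  rw [coeff, taylorCoeff_zero, hf.cuspExpansion_zero hN]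

lemma coeff_one_ne_zero (hf : IsPuncturedSphereCovering N S f) (hN : N ≠ 0) : hf.coeff 1 ≠ 0 := by
  rw [coeff, taylorCoeff_one]
  exact hf.deriv_cuspExpansion_ne_zero hN

/-- The expansion of `f`, given polynomials that compute its higher coefficients. -/
lemma hasExpansion (hf : IsPuncturedSphereCovering N S f) (hN : N ≠ 0) {C : ℕ → Polynomial ℂ}
    (hC : ∀ m, hf.coeff (m + 3) = hf.coeff 1 * (C (m + 3)).eval (hf.coeff 2 / hf.coeff 1)) :
    HasExpansion N C (fun τ => f τ) (hf.coeff 1) (hf.coeff 2) := by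
  have hA := hf.coeff_one_ne_zero hN
  refine ⟨hA, hf.exists_ne_infty, fun Y hY τ hτ => ?_⟩
  -- `Y` may be negative; on `ℍ` the conditions `Y < Im τ` and `max Y 0 < Im τ` agree.
  have hd := hf.differentiableOn_cuspExpansion hN (le_max_right Y 0)
    fun τ hτ => hY τ ((le_max_left _ _).trans_lt hτ)
  set q := Function.Periodic.qParam (N : ℝ) (τ : ℂ) with hq
  have hqb : q ∈ Metric.ball (0 : ℂ) (Real.exp (-2 * Real.pi * (max Y 0) / N)) := by
    rw [mem_ball_zero_iff]
    exact (Function.Periodic.norm_qParam_lt_iff (by positivity) _ _).mpr (max_lt hτ τ.im_pos)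
  have hsum := (hasSum_mul_pow_iff (hf.coeff_zero hN)).mp (hd.hasSum_taylorCoeff hqb)
  refine ⟨_, (hsum.mul_left (hf.coeff 1)⁻¹).congr_fun ?_, ?_⟩
  · intro m
    rw [hC m]
    field_simp
  · change (f τ : OnePoint ℂ) = _
    rw [← hf.coe_cuspExpansion hN (hY τ hτ), OnePoint.coe_eq_coe]
    field_simp
    ring

/-- The constants `A`, `B` of an expansion are the first two coefficients. -/
lemma eq_coeff_of_hasExpansion (hf : IsPuncturedSphereCovering N S f) (hN : N ≠ 0)
    {C : ℕ → Polynomial ℂ} {A B : ℂ} (h : HasExpansion N C (fun τ => f τ) A B) :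
    A = hf.coeff 1 ∧ B = hf.coeff 2 := by
  obtain ⟨hA, ⟨Y, hY⟩, hexp⟩ := h
  set e : ℕ → ℂ := fun n => match n with
    | 0 => 0
    | 1 => A
    | 2 => B
    | m + 3 => A * (C (m + 3)).eval (B / A) with he
  have hee : e = hf.coeff := by
    refine (hf.analyticAt_cuspExpansion hN).eq_taylorCoeff ?_
    have hev := eventually_exists_qParam_eq hN Y
    rw [eventually_nhdsWithin_iff] at hev
    filter_upwards [hev] with q hq
    by_cases h0 : q = 0
    · rw [h0, hf.cuspExpansion_zero hN]
      convert hasSum_zero using 2 with n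
      cases n <;> simp [he]
    · obtain ⟨τ, hτ, rfl⟩ := hq h0
      obtain ⟨s, hs, hfs⟩ := hexp Y hY τ hτ
      replace hfs := (hf.coe_cuspExpansion hN (hY τ hτ)).trans hfs
      rw [OnePoint.coe_eq_coe] at hfs
      rw [hasSum_mul_pow_iff rfl, hfs]
      convert! hs.mul_left A using 1
      · funext m
        simp only [he]
        ring
      · simp only [he]
        field_simp
        ring
  exact ⟨congrFun hee 1, congrFun hee 2⟩

end IsPuncturedSphereCovering

/-! ### Comparison of two coverings; values at the cusps. -/

namespace IsPuncturedSphereCovering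

variable {N : ℕ} {S T : Finset (OnePoint ℂ)} {f : ℍ → ↥((S : Set (OnePoint ℂ))ᶜ)}
  {g : ℍ → ↥((T : Set (OnePoint ℂ))ᶜ)}

/-- Two coverings with the same deck group `Γ(N)` differ by a Möbius transformation fixing `0`. -/
theorem exists_gl_smul (hf : IsPuncturedSphereCovering N S f)
    (hg : IsPuncturedSphereCovering N T g) :
    ∃ M : GL (Fin 2) ℂ, M • ((0 : ℂ) : OnePoint ℂ) = ((0 : ℂ) : OnePoint ℂ) ∧
      ∀ τ, (g τ : OnePoint ℂ) = M • (f τ : OnePoint ℂ) := by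
  obtain ⟨τ₀, h1, h2⟩ := ((hf.tendsto_zero.eventually_ne (coe_ne_infty (0 : ℂ))).and
    (hg.tendsto_zero.eventually_ne (coe_ne_infty (0 : ℂ)))).exists
  obtain ⟨M, hM⟩ := exists_gl_smul_eq hf.isUniversalCovering.1 hg.isUniversalCovering.1
    hf.isOpenMap_coe hg.isOpenMap_coe hf.exists_nhds_injOn hg.exists_nhds_injOn
    (fun τ σ => hf.apply_eq_iff.trans hg.apply_eq_iff.symm) S (fun p hp => hf.exists_eq hp)
    hf.apply_notMem h1 h2
  -- Both coverings tend to `0` at the cusp, so by continuity `M` fixes `0`.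
  refine ⟨M, tendsto_nhds_unique ?_ hg.tendsto_zero, hM⟩
  simp only [hM]
  exact ((OnePoint.continuous_gl_smul M).tendsto _).comp hf.tendsto_zero

end IsPuncturedSphereCovering

lemma OnePoint.gl_entries_of_smul_zero {M : GL (Fin 2) ℂ}
    (hM : M • ((0 : ℂ) : OnePoint ℂ) = ((0 : ℂ) : OnePoint ℂ)) :
    M 0 1 = 0 ∧ M 1 1 ≠ 0 ∧ M 0 0 ≠ 0 := by
  have hdet : M 0 0 * M 1 1 - M 0 1 * M 1 0 ≠ 0 := by
    have := M.det_ne_zero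
    rwa [Matrix.det_fin_two] at this
  rw [smul_some_eq_ite] at hM
  simp only [mul_zero, zero_add] at hM
  by_cases h : M 1 1 = 0
  · rw [if_pos h] at hM
    exact absurd hM (infty_ne_coe _)
  · rw [if_neg h, OnePoint.coe_eq_coe, div_eq_zero_iff] at hM
    have h01 := hM.resolve_right h
    refine ⟨h01, h, fun h00 => hdet ?_⟩
    rw [h01, h00]; ring

/-- A Möbius transformation that fixes `0` and two further points is the identity. -/
lemma OnePoint.gl_entries_of_fixed_points {M : GL (Fin 2) ℂ} {s : Finset (OnePoint ℂ)}
    (hs : 3 ≤ s.card) (h0 : ((0 : ℂ) : OnePoint ℂ) ∈ s) (hM : ∀ p ∈ s, M • p = p) :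
    M 1 0 = 0 ∧ M 0 0 = M 1 1 := by
  classical
  obtain ⟨h01, h11, h00⟩ := gl_entries_of_smul_zero (hM _ h0)
  have hcard : 1 < (s.erase ((0 : ℂ) : OnePoint ℂ)).card := by
    rw [Finset.card_erase_of_mem h0]; omega
  obtain ⟨p, hp, p', hp', hne⟩ := Finset.one_lt_card.mp hcard
  rw [Finset.mem_erase] at hp hp'
  have hfin : ∀ z : ℂ, ((z : OnePoint ℂ) ≠ ((0 : ℂ) : OnePoint ℂ) ∧ (z : OnePoint ℂ) ∈ s) →
      M 0 0 = M 1 0 * z + M 1 1 := by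
    rintro z ⟨hz, hzs⟩
    have h := hM _ hzs
    rw [Ne, OnePoint.coe_eq_coe] at hz
    rw [smul_some_eq_ite, h01, add_zero] at h
    by_cases hd : M 1 0 * z + M 1 1 = 0
    · rw [if_pos hd] at h
      exact absurd h (infty_ne_coe _)
    · rw [if_neg hd, OnePoint.coe_eq_coe, div_eq_iff hd] at h
      exact mul_right_cancel₀ hz (h.trans (mul_comm _ _))
  induction p using OnePoint.rec with
  | infty =>
    have h10 : M 1 0 = 0 := smul_infty_eq_self_iff.mp (hM _ hp.2)
    induction p' using OnePoint.rec with
    | infty => exact absurd rfl hne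
    | coe z => exact ⟨h10, by simpa [h10] using hfin z hp'⟩
  | coe w =>
    have hw := hfin w hp
    induction p' using OnePoint.rec with
    | infty =>
      have h10 : M 1 0 = 0 := smul_infty_eq_self_iff.mp (hM _ hp'.2)
      exact ⟨h10, by simpa [h10] using hw⟩
    | coe z =>
      have hz := hfin z hp'
      have hwz : w - z ≠ 0 := by
        rw [sub_ne_zero]; rintro rfl; exact hne rfl
      have h10 : M 1 0 = 0 := by
        have : M 1 0 * (w - z) = 0 := by linear_combination hz - hw
        exact (mul_eq_zero.mp this).resolve_right hwz
      exact ⟨h10, by simpa [h10] using hw⟩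

namespace IsPuncturedSphereCovering

variable {N : ℕ} {S T : Finset (OnePoint ℂ)} {f : ℍ → ↥((S : Set (OnePoint ℂ))ᶜ)}
  {g : ℍ → ↥((T : Set (OnePoint ℂ))ᶜ)}

/-- The relation `g (1 + v f) = u f` between two coverings, in terms of coefficients. -/
lemma coeff_relation (hf : IsPuncturedSphereCovering N S f)
    (hg : IsPuncturedSphereCovering N T g) (hN : N ≠ 0) {M : GL (Fin 2) ℂ}
    (h0 : M • ((0 : ℂ) : OnePoint ℂ) = ((0 : ℂ) : OnePoint ℂ))
    (hM : ∀ τ, (g τ : OnePoint ℂ) = M • (f τ : OnePoint ℂ)) (n : ℕ) :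
    hg.coeff n + M 1 0 / M 1 1 * ∑ i ∈ Finset.range (n + 1), hg.coeff i * hf.coeff (n - i) =
      M 0 0 / M 1 1 * hf.coeff n := by
  obtain ⟨h01, h11, h00⟩ := gl_entries_of_smul_zero h0
  have haf := hf.analyticAt_cuspExpansion hN
  have hag := hg.analyticAt_cuspExpansion hN
  set φ := cuspExpansion N fun τ => (f τ : OnePoint ℂ) with hφ
  set χ := cuspExpansion N fun τ => (g τ : OnePoint ℂ) with hχ
  have hev : (χ + fun q => M 1 0 / M 1 1 * (χ * φ) q) =ᶠ[𝓝 0] fun q => M 0 0 / M 1 1 * φ q := by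
    obtain ⟨Y, hY⟩ := hf.exists_ne_infty
    obtain ⟨Y', hY'⟩ := hg.exists_ne_infty
    have hq := eventually_exists_qParam_eq hN (max Y Y')
    rw [eventually_nhdsWithin_iff] at hq
    filter_upwards [hq] with q hq
    simp only [Pi.add_apply, Pi.mul_apply]
    by_cases hq0 : q = 0
    · rw [hq0, hφ, hχ, hf.cuspExpansion_zero hN, hg.cuspExpansion_zero hN]
      simp
    · obtain ⟨τ, hτ, rfl⟩ := hq hq0
      have h1 := hM τ
      rw [← hf.coe_cuspExpansion hN (hY τ ((le_max_left _ _).trans_lt hτ)),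
        ← hg.coe_cuspExpansion hN (hY' τ ((le_max_right _ _).trans_lt hτ)), ← hφ, ← hχ,
        smul_some_eq_ite, h01, add_zero] at h1
      split_ifs at h1 with hd
      · exact absurd h1 (coe_ne_infty _)
      · rw [OnePoint.coe_eq_coe, eq_div_iff hd] at h1
        field_simp
        linear_combination h1
  have h2 := congrFun (taylorCoeff_congr hev) n
  have hmul : AnalyticAt ℂ (fun q => M 1 0 / M 1 1 * (χ * φ) q) 0 :=
    analyticAt_const.mul (hag.mul haf)
  rw [taylorCoeff_add hag hmul, taylorCoeff_const_mul,
    taylorCoeff_const_mul, taylorCoeff_mul hag haf] at h2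
  exact h2

/-- Since both constant terms vanish, the product `g f` starts with `q ^ 2`: the first coefficient
only scales, and the second picks up the correction in `A ^ 2`. -/
lemma coeff_one_two (hf : IsPuncturedSphereCovering N S f)
    (hg : IsPuncturedSphereCovering N T g) (hN : N ≠ 0) {M : GL (Fin 2) ℂ}
    (h0 : M • ((0 : ℂ) : OnePoint ℂ) = ((0 : ℂ) : OnePoint ℂ))
    (hM : ∀ τ, (g τ : OnePoint ℂ) = M • (f τ : OnePoint ℂ)) :
    hg.coeff 1 = M 0 0 / M 1 1 * hf.coeff 1 ∧
      hg.coeff 2 = M 0 0 / M 1 1 * (hf.coeff 2 - M 1 0 / M 1 1 * hf.coeff 1 ^ 2) := by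
  have h1 := hf.coeff_relation hg hN h0 hM 1
  have h2 := hf.coeff_relation hg hN h0 hM 2
  simp only [Finset.sum_range_succ, Finset.sum_range_zero, hf.coeff_zero hN, hg.coeff_zero hN,
    Nat.sub_self, zero_mul, mul_zero, zero_add, add_zero] at h1 h2
  refine ⟨h1, ?_⟩
  simp only [Nat.reduceSub] at h2
  rw [h1] at h2
  linear_combination h2

/-- The Möbius transformation between two coverings of the complement of `S` preserves `S`. -/
lemma smul_mem_iff {g : ℍ → ↥((S : Set (OnePoint ℂ))ᶜ)} (hf : IsPuncturedSphereCovering N S f)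
    {M : GL (Fin 2) ℂ} (hM : ∀ τ, (g τ : OnePoint ℂ) = M • (f τ : OnePoint ℂ)) (p : OnePoint ℂ) :
    M • p ∈ S ↔ p ∈ S := by
  classical
  have h1 : ∀ p, M • p ∈ S → p ∈ S := by
    intro p hp
    by_contra hpS
    obtain ⟨τ, rfl⟩ := hf.exists_eq hpS
    rw [← hM τ] at hp
    exact (g τ).2 hp
  refine ⟨h1 p, fun hp => ?_⟩
  -- `M⁻¹` maps the finite set `S` injectively into itself, hence onto itself.
  have h2 : S.image (fun s => M⁻¹ • s) ⊆ S := by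
    intro t ht
    obtain ⟨s, hs, rfl⟩ := Finset.mem_image.mp ht
    exact h1 _ (by rwa [smul_inv_smul])
  have h3 : S.image (fun s => M⁻¹ • s) = S :=
    Finset.eq_of_subset_of_card_le h2
      (Finset.card_image_of_injective _ (MulAction.injective M⁻¹)).ge
  rw [← h3] at hp
  obtain ⟨s, hs, rfl⟩ := Finset.mem_image.mp hp
  rwa [smul_inv_smul]

/-- If `f` has a value at every cusp, then every puncture is the value at some cusp. -/
theorem exists_valueAtCusp_eq (hf : IsPuncturedSphereCovering N S f) (hN : N ≠ 0)
    {v : SL(2, ℤ) → OnePoint ℂ}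
    (hv : ∀ γ, HasValueAtCusp (fun τ => (f τ : OnePoint ℂ)) γ (v γ)) {p : OnePoint ℂ}
    (hp : p ∈ S) : ∃ γ, v γ = p := by
  by_contra! hne
  have : NeZero N := ⟨hN⟩
  -- On a translate of the fundamental domain `f` stays away from `p`: the high part lies near `v ρ
  -- ≠ p`, and the low part is compact and omits `p`.
  have hloc : ∀ ρ : SL(2, ℤ), ∀ᶠ x in 𝓝 p, ∀ τ ∈ ModularGroup.fd, (f (ρ • τ) : OnePoint ℂ) ≠ x := by
    intro ρ
    obtain ⟨U, V, hU, hV, hvU, hpV, hUV⟩ := t2_separation (hne ρ)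
    obtain ⟨Y, hY⟩ := (atImInfty_mem _).mp (hv ρ (hU.mem_nhds hvU))
    have hcont : Continuous fun τ : ℍ => (f (ρ • τ) : OnePoint ℂ) :=
      hf.isUniversalCovering.1.1.comp (continuous_const_smul (ρ : GL (Fin 2) ℝ))
    have hK := (ModularGroup.isCompact_truncatedFundamentalDomain Y).image hcont
    have hpK : p ∉ (fun τ : ℍ => (f (ρ • τ) : OnePoint ℂ)) ''
        ModularGroup.truncatedFundamentalDomain Y := by
      rintro ⟨τ, -, hτ⟩
      exact hf.apply_notMem (ρ • τ) (by simpa only [hτ] using hp)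
    filter_upwards [hV.mem_nhds hpV, hK.isClosed.isOpen_compl.mem_nhds hpK] with x hx1 hx2 τ hτ hx
    rcases le_total τ.im Y with h | h
    · exact hx2 ⟨τ, ⟨hτ, h⟩, hx⟩
    · exact hUV.notMem_of_mem_left (hY τ h) (by simpa only [hx] using hx1)
  -- `Γ(N)` has finite index, so finitely many translates suffice. Yet points outside `S`, all of
  -- them values of `f`, accumulate at `p`.
  have hall : ∀ᶠ x in 𝓝 p, ∀ c : SL(2, ℤ) ⧸ CongruenceSubgroup.Gamma N,
      ∀ τ ∈ ModularGroup.fd, (f (c.out⁻¹ • τ) : OnePoint ℂ) ≠ x :=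
    eventually_all.mpr fun c => hloc _
  have hdense := (dense_univ (X := OnePoint ℂ)).sdiff_finite S.finite_toSet
  obtain ⟨x, ⟨-, hxS⟩, hx⟩ :=
    (mem_closure_iff_frequently.mp (hdense p)).and_eventually hall |>.exists
  obtain ⟨τ, rfl⟩ := hf.exists_eq hxS
  obtain ⟨h, hh⟩ := ModularGroup.exists_smul_mem_fd τ
  refine hx (QuotientGroup.mk h) _ hh ?_
  obtain ⟨δ, hδ⟩ := QuotientGroup.mk_out_eq_mul (CongruenceSubgroup.Gamma N) h
  rw [hδ, mul_inv_rev, smul_smul, inv_mul_cancel_right]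
  exact hf.apply_smul (inv_mem δ.2) τ

end IsPuncturedSphereCovering

/-! ### The universal polynomials and the theorem. -/

lemma three_le_numPunctures {N : ℕ} (hN : N = 2 ∨ N = 3 ∨ N = 4 ∨ N = 5) : 3 ≤ numPunctures N := by
  rcases hN with rfl | rfl | rfl | rfl <;> simp [numPunctures]

/-- There are universal polynomials for the coefficients of all coverings with deck
group `Γ(N)`. -/
theorem exists_polynomials_hasExpansion {N : ℕ} (hN : N ≠ 0) :
    ∃ C : ℕ → Polynomial ℂ, ∀ (S : Finset (OnePoint ℂ)) (f : ℍ → ↥((S : Set (OnePoint ℂ))ᶜ))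
      (hf : IsPuncturedSphereCovering N S f),
      HasExpansion N C (fun τ => (f τ : OnePoint ℂ)) (hf.coeff 1) (hf.coeff 2) := by
  by_cases hex : ∃ (S : Finset (OnePoint ℂ)) (f : ℍ → ↥((S : Set (OnePoint ℂ))ᶜ)),
      IsPuncturedSphereCovering N S f
  swap
  · exact ⟨0, fun S f hf => absurd ⟨S, f, hf⟩ hex⟩
  obtain ⟨S₀, f₀, h₀⟩ := hex
  choose p hp using exists_polynomial_coeff h₀.coeff (h₀.coeff_zero hN)
  have ha := h₀.coeff_one_ne_zero hN
  set a₁ := h₀.coeff 1 with ha₁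
  set a₂ := h₀.coeff 2 with ha₂
  -- From `A = u * a₁` and `B = u * (a₂ - v * a₁ ^ 2)` one gets `v = a₁⁻¹ * (a₂ / a₁ - B / A)`. The
  -- `m`-th coefficient `u * p m (v)` is divided by `A`, which leaves the factor `a₁⁻¹`.
  refine ⟨fun m => Polynomial.C a₁⁻¹ *
    (p m).comp (Polynomial.C a₁⁻¹ * (Polynomial.C (a₂ / a₁) - Polynomial.X)), fun S f hf => ?_⟩
  refine hf.hasExpansion hN fun m => ?_
  obtain ⟨M, hM0, hM⟩ := h₀.exists_gl_smul hf
  obtain ⟨-, h11, h00⟩ := gl_entries_of_smul_zero hM0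
  obtain ⟨h1, h2⟩ := h₀.coeff_one_two hf hN hM0 hM
  have h3 := hp (m + 3) (M 0 0 / M 1 1) (M 1 0 / M 1 1) hf.coeff
    (h₀.coeff_relation hf hN hM0 hM)
  have hu : M 0 0 / M 1 1 ≠ 0 := div_ne_zero h00 h11
  have hv : a₁⁻¹ * (a₂ / a₁ - hf.coeff 2 / hf.coeff 1) = M 1 0 / M 1 1 := by
    rw [h1, h2, ← ha₁, ← ha₂]
    generalize M 0 0 / M 1 1 = u at hu
    generalize M 1 0 / M 1 1 = v
    field_simp
    ring
  rw [h3, Polynomial.eval_mul, Polynomial.eval_comp, Polynomial.eval_mul, Polynomial.eval_sub,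
    Polynomial.eval_C, Polynomial.eval_C, Polynomial.eval_X, hv, h1, ← ha₁]
  field_simp

end

/-- The polynomials `C m` depend on `N` only. The constants `A, B` are determined by the punctures,
labelled by the cusps at which they are the values of `f`; if only the unlabelled set `S` of
punctures is given, they are determined up to the Möbius symmetries `z ↦ az / (cz + d)` of `S`
that fix `0`. -/
theorem theorem1p2 (N : ℕ) (hN : N = 2 ∨ N = 3 ∨ N = 4 ∨ N = 5) :
    ∃ C : ℕ → Polynomial ℂ,
      (∀ (S : Finset (OnePoint ℂ)) (f : ℍ → ↥((S : Set (OnePoint ℂ))ᶜ)),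
        IsPuncturedSphereCovering N S f →
        ∃ A B : ℂ, HasExpansion N C (fun τ => (f τ : OnePoint ℂ)) A B) ∧
      (∀ (S T : Finset (OnePoint ℂ)) (f : ℍ → ↥((S : Set (OnePoint ℂ))ᶜ))
        (g : ℍ → ↥((T : Set (OnePoint ℂ))ᶜ)) (A B A' B' : ℂ),
        IsPuncturedSphereCovering N S f → IsPuncturedSphereCovering N T g →
        HasExpansion N C (fun τ => (f τ : OnePoint ℂ)) A B →
        HasExpansion N C (fun τ => (g τ : OnePoint ℂ)) A' B' →
        (∀ γ : SL(2, ℤ), ∃ p : OnePoint ℂ,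
          HasValueAtCusp (fun τ => (f τ : OnePoint ℂ)) γ p ∧
          HasValueAtCusp (fun τ => (g τ : OnePoint ℂ)) γ p) →
        A' = A ∧ B' = B) ∧
      (∀ (S : Finset (OnePoint ℂ)) (f g : ℍ → ↥((S : Set (OnePoint ℂ))ᶜ)) (A B A' B' : ℂ),
        IsPuncturedSphereCovering N S f → IsPuncturedSphereCovering N S g →
        HasExpansion N C (fun τ => (f τ : OnePoint ℂ)) A B →
        HasExpansion N C (fun τ => (g τ : OnePoint ℂ)) A' B' →
        ∃ M : GL (Fin 2) ℂ,
          M • ((0 : ℂ) : OnePoint ℂ) = ((0 : ℂ) : OnePoint ℂ) ∧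
          (∀ p : OnePoint ℂ, M • p ∈ S ↔ p ∈ S) ∧
          A' = M 0 0 / M 1 1 * A ∧
          B' = M 0 0 / M 1 1 * (B - M 1 0 / M 1 1 * A ^ 2)) := by
  have hN0 : N ≠ 0 := by omega
  obtain ⟨C, hC⟩ := exists_polynomials_hasExpansion hN0
  refine ⟨C, fun S f hf => ⟨_, _, hC S f hf⟩, ?_, ?_⟩
  · intro S T f g A B A' B' hf hg hfe hge hcusp
    obtain ⟨rfl, rfl⟩ := hf.eq_coeff_of_hasExpansion hN0 hfe
    obtain ⟨rfl, rfl⟩ := hg.eq_coeff_of_hasExpansion hN0 hge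
    obtain ⟨M, hM0, hM⟩ := hf.exists_gl_smul hg
    choose v hvf hvg using hcusp
    -- Each puncture of `f` is a limit at some cusp, where `g = M • f` has the same limit.
    have hfix : ∀ p ∈ S, M • p = p := by
      intro p hp
      obtain ⟨γ, rfl⟩ := hf.exists_valueAtCusp_eq hN0 hvf hp
      refine tendsto_nhds_unique ?_ (hvg γ)
      simp only [hM]
      exact ((OnePoint.continuous_gl_smul M).tendsto _).comp (hvf γ)
    have hcard : 3 ≤ S.card := hf.card_eq ▸ three_le_numPunctures hN
    obtain ⟨h10, h00⟩ := gl_entries_of_fixed_points hcard hf.zero_mem hfix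
    obtain ⟨-, h11, -⟩ := gl_entries_of_smul_zero hM0
    obtain ⟨h1, h2⟩ := hf.coeff_one_two hg hN0 hM0 hM
    rw [h10, h00, div_self h11, zero_div] at h2
    rw [h00, div_self h11] at h1
    exact ⟨by rw [h1, one_mul], by rw [h2]; ring⟩
  · intro S f g A B A' B' hf hg hfe hge
    obtain ⟨rfl, rfl⟩ := hf.eq_coeff_of_hasExpansion hN0 hfe
    obtain ⟨rfl, rfl⟩ := hg.eq_coeff_of_hasExpansion hN0 hge
    obtain ⟨M, hM0, hM⟩ := hf.exists_gl_smul hg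
    obtain ⟨h1, h2⟩ := hf.coeff_one_two hg hN0 hM0 hM
    exact ⟨M, hM0, hf.smul_mem_iff hM, h1, h2⟩
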